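/- Let $K$ be an algebraically closed field of characteristic zero and let $Q$ be a Euclidean quiver, i.e. a finite quiver without oriented cycles whose underlying graph is one of the extended Dynkin graphs $\widetilde A_n$ $(n\ge 1)$, $\widetilde D_n$ $(n\ge 4)$, $\widetilde E_6,\widetilde E_7,\widetilde E_8$. Write $ta$ and $ha$ for the tail and head of an arrow $a$. All representations are finite-dimensional representations of $Q$ over $K$. Let $\langle\alpha,\beta\rangle=\sum_{x\in Q_0}\alpha(x)\beta(x)-\sum_{a\in Q_1}\alpha(ta)\beta(ha)$ be the Euler form on $\mathbb Z^{Q_0}$. A representation $V$ is Schur if $\operatorname{End}_Q(V)\simeq K$ and exceptional if moreover $\operatorname{Ext}^1_Q(V,V)=0$. Let $\delta$ be the unique imaginary Schur root of $Q$, i.e. the dimension vector of a Schur representation with $\langle\delta,\delta\rangle\le 0$. A representation is called preprojective, regular, or preinjective if all its indecomposable direct summands $W$ have defect $\langle\delta,\underline{\dim}\,W\rangle$ negative, zero, or positive, respectively. Let $V_1,\dots,V_r$ be an orthogonal Schur sequence of non-regular representations: each $V_i$ is Schur and not regular, and $\operatorname{Hom}_Q(V_i,V_j)=0$ for all $i\ne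 j$. Then the sequence can be rearranged into an orthogonal exceptional sequence in which every preprojective representation comes before every preinjective one: there is a permutation $\sigma$ of $\{1,\dots,r\}$ such that, with $W_i=V_{\sigma(i)}$, each $W_i$ is exceptional, $\operatorname{Hom}_Q(W_i,W_j)=0$ for all $i\ne j$, $\operatorname{Ext}^1_Q(W_i,W_j)=0$ for all $i<j$, and $i<j$ whenever $W_i$ is preprojective and $W_j$ is preinjective. -/

import Mathlib

universe u v q w w₁ w₂

/-- A finite-dimensional representation over `K` of a quiver `Q`, with spaces in `Type w`. -/
structure QuiverRep (K : Type u) [Field K] (Q : Type v) [Quiver.{q} Q] where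
  obj : Q → Type w
  [addCommGroup : ∀ x, AddCommGroup (obj x)]
  [module : ∀ x, Module K (obj x)]
  [finite : ∀ x, Module.Finite K (obj x)]
  map : ∀ {x y : Q}, (x ⟶ y) → (obj x →ₗ[K] obj y)

namespace QuiverRep

attribute [instance] QuiverRep.addCommGroup QuiverRep.module QuiverRep.finite

variable {K : Type u} [Field K] {Q : Type v} [Quiver.{q} Q]

/-- The space `Hom_Q(V, W)`, as a subspace of `∏ₓ Hom_K(V(x), W(x))`. -/
def Hom (V : QuiverRep.{u, v, q, w₁} K Q) (W : QuiverRep.{u, v, q, w₂} K Q) :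
    Submodule K (∀ x, V.obj x →ₗ[K] W.obj x) where
  carrier := {f | ∀ (x y : Q) (a : x ⟶ y), f y ∘ₗ V.map a = W.map a ∘ₗ f x}
  zero_mem' := by
    intro x y a
    simp
  add_mem' := by
    intro f g hf hg x y a
    simp [LinearMap.add_comp, LinearMap.comp_add, hf x y a, hg x y a]
  smul_mem' := by
    intro c f hf x y a
    simp [LinearMap.smul_comp, LinearMap.comp_smul, hf x y a]

/-- The endomorphism algebra `End_Q(V)`, as a subalgebra of `∏ₓ End_K(V(x))`. -/
def End (V : QuiverRep.{u, v, q, w} K Q) : Subalgebra K (∀ x, Module.End K (V.obj x)) where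
  carrier := {f | f ∈ Hom V V}
  mul_mem' := by
    intro f g hf hg x y a
    change (f y ∘ₗ g y) ∘ₗ V.map a = V.map a ∘ₗ (f x ∘ₗ g x)
    rw [LinearMap.comp_assoc, hg x y a, ← LinearMap.comp_assoc, hf x y a, LinearMap.comp_assoc]
  add_mem' := fun hf hg => (Hom V V).add_mem hf hg
  algebraMap_mem' := by
    intro c x y a
    ext m
    simp [Algebra.algebraMap_eq_smul_one]

/-- Two representations are isomorphic. -/
def Isomorphic (V : QuiverRep.{u, v, q, w₁} K Q) (W : QuiverRep.{u, v, q, w₂} K Q) : Prop :=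
  ∃ f ∈ Hom V W, ∀ x, Function.Bijective (f x)

/-- The zero representations. -/
def IsZero (V : QuiverRep.{u, v, q, w} K Q) : Prop := ∀ x, Subsingleton (V.obj x)

/-- The direct sum `V ⊕ W`. -/
def directSum (V W : QuiverRep.{u, v, q, w} K Q) : QuiverRep.{u, v, q, w} K Q where
  obj x := V.obj x × W.obj x
  map a := (V.map a).prodMap (W.map a)

def IsIndecomposable (V : QuiverRep.{u, v, q, w} K Q) : Prop :=
  ¬ V.IsZero ∧ ∀ A B : QuiverRep.{u, v, q, w} K Q,
    Isomorphic V (A.directSum B) → A.IsZero ∨ B.IsZero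

/-- `W` is (isomorphic to) a direct summand of `V`. -/
def IsSummand (W V : QuiverRep.{u, v, q, w} K Q) : Prop :=
  ∃ U : QuiverRep.{u, v, q, w} K Q, Isomorphic V (W.directSum U)

/-- Schur representations: `End_Q(V) ≃ K`. -/
def IsSchur (V : QuiverRep.{u, v, q, w} K Q) : Prop := Nonempty (V.End ≃ₐ[K] K)

/-- `Ext¹_Q(V, W) = 0`, in terms of extensions: every short exact sequence
`0 → W → E → V → 0` of representations splits. -/
def ExtOneVanishes (V W : QuiverRep.{u, v, q, w} K Q) : Prop :=
  ∀ (E : QuiverRep.{u, v, q, w} K Q), ∀ i ∈ Hom W E, ∀ p ∈ Hom E V,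
    (∀ x, Function.Injective (i x)) → (∀ x, Function.Surjective (p x)) →
    (∀ x, Function.Exact (i x) (p x)) →
    ∃ s ∈ Hom V E, ∀ x, p x ∘ₗ s x = LinearMap.id

/-- Exceptional representations. -/
def IsExceptional (V : QuiverRep.{u, v, q, w} K Q) : Prop := V.IsSchur ∧ ExtOneVanishes V V

/-- Orthogonal Schur sequences `V₁, …, Vᵣ`. -/
def IsOrthogonalSchurSequence {r : ℕ} (V : Fin r → QuiverRep.{u, v, q, w} K Q) : Prop :=
  (∀ i, (V i).IsSchur) ∧ ∀ i j, i ≠ j → Hom (V i) (V j) = ⊥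

/-- Exceptional sequences `V₁, …, Vᵣ`. -/
def IsExceptionalSequence {r : ℕ} (V : Fin r → QuiverRep.{u, v, q, w} K Q) : Prop :=
  (∀ i, (V i).IsExceptional) ∧
    ∀ i j, i < j → Hom (V i) (V j) = ⊥ ∧ ExtOneVanishes (V i) (V j)

/-- Orthogonal exceptional sequences `V₁, …, Vᵣ`. -/
def IsOrthogonalExceptionalSequence {r : ℕ} (V : Fin r → QuiverRep.{u, v, q, w} K Q) : Prop :=
  IsExceptionalSequence V ∧ ∀ i j, i ≠ j → Hom (V i) (V j) = ⊥

/-- The dimension vector of `V`, as an element of `ℤ^{Q₀}`. -/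
noncomputable def dimVec (V : QuiverRep.{u, v, q, w} K Q) : Q → ℤ :=
  fun x => (Module.finrank K (V.obj x) : ℤ)

end QuiverRep

/-- The Euler form `⟨α, β⟩ = ∑ₓ α(x) β(x) - ∑ₐ α(ta) β(ha)`; the arrows are grouped by their
tail `x` and head `y`. -/
def eulerForm {Q : Type v} [Quiver.{q} Q] [Fintype Q] [∀ x y : Q, Fintype (x ⟶ y)]
    (α β : Q → ℤ) : ℤ :=
  ∑ x, α x * β x - ∑ x, ∑ y, ∑ _a : x ⟶ y, α x * β y

/-- The Euclidean (extended Dynkin) graphs: `A n` is `Ã_{n+1}`, `D n` is `D̃_{n+4}`. -/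
inductive EuclideanGraph where
  | A (n : ℕ)
  | D (n : ℕ)
  | E6
  | E7
  | E8

namespace EuclideanGraph

/-- The number of vertices. -/
def numVertices : EuclideanGraph → ℕ
  | A n => n + 2
  | D n => n + 5
  | E6 => 7
  | E7 => 8
  | E8 => 9

/-- The edges, on vertices labelled from `0`, each listed in one direction.
`A n`: the cycle `0 — 1 — ⋯ — (n + 1) — 0` (for `n = 0` a double edge).
`D n`: the path `1 — 2 — ⋯ — (n + 3)` with further edges `0 — 2` and `(n + 2) — (n + 4)`.
`E6`: the path `0 — ⋯ — 4` with the branch `2 — 5 — 6`.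
`E7`: the path `0 — ⋯ — 6` with the branch `3 — 7`.
`E8`: the path `0 — ⋯ — 7` with the branch `2 — 8`. -/
def edge : EuclideanGraph → ℕ → ℕ → Bool
  | A n, i, j => decide (j = (i + 1) % (n + 2))
  | D n, i, j => decide ((1 ≤ i ∧ j = i + 1 ∧ j ≤ n + 3) ∨ (i = 0 ∧ j = 2) ∨
      (i = n + 2 ∧ j = n + 4))
  | E6, i, j => decide ((j = i + 1 ∧ j ≤ 4) ∨ (i = 2 ∧ j = 5) ∨ (i = 5 ∧ j = 6))
  | E7, i, j => decide ((j = i + 1 ∧ j ≤ 6) ∨ (i = 3 ∧ j = 7))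
  | E8, i, j => decide ((j = i + 1 ∧ j ≤ 7) ∨ (i = 2 ∧ j = 8))

/-- The number of edges joining `i` and `j`. -/
def numEdges (t : EuclideanGraph) (i j : ℕ) : ℕ := (t.edge i j).toNat + (t.edge j i).toNat

end EuclideanGraph

/-- `Q` is a Euclidean quiver: it has no oriented cycles, and its underlying graph is one of the
Euclidean graphs (in particular it is connected and has no loops). -/
def IsEuclideanQuiver (Q : Type v) [Quiver.{q} Q] [∀ x y : Q, Fintype (x ⟶ y)] : Prop :=
  (∀ (x : Q) (p : Quiver.Path x x), p = Quiver.Path.nil) ∧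
  ∃ (t : EuclideanGraph) (e : Q ≃ Fin t.numVertices), ∀ x y : Q,
    Fintype.card (x ⟶ y) + Fintype.card (y ⟶ x) = t.numEdges (e x) (e y)

/-- `δ` is an imaginary Schur root: the dimension vector of a Schur representation, with
`q(δ) ≤ 0` for the Tits form `q`. -/
def IsImaginarySchurRoot (K : Type u) [Field K] {Q : Type v} [Quiver.{q} Q] [Fintype Q]
    [∀ x y : Q, Fintype (x ⟶ y)] (δ : Q → ℤ) : Prop :=
  (∃ V : QuiverRep.{u, v, q, u} K Q, V.IsSchur ∧ V.dimVec = δ) ∧ eulerForm δ δ ≤ 0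

namespace QuiverRep

variable {K : Type u} [Field K] {Q : Type v} [Quiver.{q} Q] [Fintype Q]
  [∀ x y : Q, Fintype (x ⟶ y)]

/-- The defect `⟨δ, dim V⟩`. -/
noncomputable def defect (δ : Q → ℤ) (V : QuiverRep.{u, v, q, w} K Q) : ℤ :=
  eulerForm δ V.dimVec

def IsPreprojective (δ : Q → ℤ) (V : QuiverRep.{u, v, q, w} K Q) : Prop :=
  ∀ W : QuiverRep.{u, v, q, w} K Q, W.IsIndecomposable → W.IsSummand V → W.defect δ < 0

def IsRegular (δ : Q → ℤ) (V : QuiverRep.{u, v, q, w} K Q) : Prop :=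
  ∀ W : QuiverRep.{u, v, q, w} K Q, W.IsIndecomposable → W.IsSummand V → W.defect δ = 0

def IsPreinjective (δ : Q → ℤ) (V : QuiverRep.{u, v, q, w} K Q) : Prop :=
  ∀ W : QuiverRep.{u, v, q, w} K Q, W.IsIndecomposable → W.IsSummand V → 0 < W.defect δ

end QuiverRep

/-!
Let `h` be the positive additive function of the Euclidean graph. The identity
`2 q(α) = ∑ₐ h(ta) h(ha) (α(ta)/h(ta) - α(ha)/h(ha))²` shows that the Tits form `q` is positive
semidefinite with radical `ℚ h` (`IsAdditiveWeight.two_mul_eulerForm`,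
`IsAdditiveWeight.exists_smul_eq_smul`). So `δ` is a positive multiple of `h`, and the defect may be
computed with `h`. Together with `dim Hom(X, Z) - dim Ext¹(X, Z) = ⟨dim X, dim Z⟩`
(`QuiverRep.finrank_hom_sub_finrank_DExt`), positivity of `q` outside its radical gives two
facts about bricks (Schur representations) of nonzero defect:

* such a brick has no self-extensions (`QuiverRep.finrank_DExt_self_eq_zero`);
* among finitely many pairwise orthogonal ones whose defects have the same sign, one has no
  extensions by the others (`QuiverRep.exists_first`): otherwise the sum `s` of the dimension
  vectors would have `q(s) ≤ 0`, hence defect `0`.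

What remains is that `Ext¹(P, I) = 0` for a brick `P` of negative and a brick `I` of positive
defect (`QuiverRep.not_isBadPair`). For this the Auslander–Reiten translate `τX` is built, with
value `D Ext¹(X, P_y)` at the vertex `y`; it satisfies `D Ext¹(X, Z) ≃ Hom(Z, τX)`
(`QuiverRep.DExtEquivHomTau`). If the brick `X` is not projective, then it has no nonzero morphism
to a projective, `dim τX` is the Coxeter transform of `dim X`, and `dim Ext¹(Z, τX)` equals
`dim Hom(X, Z)`; in particular `τX` is again a brick of the same defect. Bricks of positive defect
are never projective, so `Ext¹(P, I) ≠ 0` gives `Ext¹(τP, τI) ≠ 0`, and this can be repeated for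
ever. The dimension vectors of `P, τP, τ²P, …` would then form an infinite Coxeter orbit of
nonnegative vectors of negative defect, which does not exist
(`IsAdditiveWeight.not_coxeter_orbit`).

The ordering is then obtained greedily: a set of remaining representations is headed by one of
negative defect as long as there is any (`exists_perm_of_exists_first`).
-/

universe w₃

/-! ### Extensions, and morphisms from bricks to projectives -/

namespace QuiverRep

variable {K : Type u} [Field K] {Q : Type v} [Quiver.{q} Q]

/-- The coboundary map `∏ₓ Hom_K(X(x), Z(x)) → ∏ₐ Hom_K(X(ta), Z(ha))`, whose kernel is
`Hom_Q(X, Z)` and whose cokernel is `Ext¹_Q(X, Z)`. -/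
def coboundary (X : QuiverRep.{u, v, q, w₁} K Q) (Z : QuiverRep.{u, v, q, w₂} K Q) :
    (∀ x, X.obj x →ₗ[K] Z.obj x) →ₗ[K] (∀ x y (_ : x ⟶ y), X.obj x →ₗ[K] Z.obj y) where
  toFun f := fun x y a => f y ∘ₗ X.map a - Z.map a ∘ₗ f x
  map_add' f g := by
    funext x y a
    simp only [Pi.add_apply, LinearMap.add_comp, LinearMap.comp_add]
    abel
  map_smul' c f := by
    funext x y a
    simp only [Pi.smul_apply, LinearMap.smul_comp, LinearMap.comp_smul, RingHom.id_apply, smul_sub]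

theorem ker_coboundary (X : QuiverRep.{u, v, q, w₁} K Q) (Z : QuiverRep.{u, v, q, w₂} K Q) :
    LinearMap.ker (coboundary X Z) = Hom X Z := by
  ext f
  rw [LinearMap.mem_ker]
  constructor
  · intro h x y a
    exact sub_eq_zero.1 (congrFun (congrFun (congrFun h x) y) a)
  · intro h
    funext x y a
    exact sub_eq_zero.2 (h x y a)

theorem comp_mem_hom {X : QuiverRep.{u, v, q, w₁} K Q} {Y : QuiverRep.{u, v, q, w₂} K Q}
    {Z : QuiverRep.{u, v, q, w₃} K Q} {g : ∀ x, Y.obj x →ₗ[K] Z.obj x}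
    {f : ∀ x, X.obj x →ₗ[K] Y.obj x} (hg : g ∈ Hom Y Z) (hf : f ∈ Hom X Y) :
    (fun x => g x ∘ₗ f x) ∈ Hom X Z := by
  intro x y a
  rw [LinearMap.comp_assoc, hf x y a, ← LinearMap.comp_assoc, hg x y a, LinearMap.comp_assoc]

/-- If the coboundary map is surjective, i.e. `Ext¹_Q(V, W) = 0`, then short exact sequences
`0 → W → E → V → 0` split: the failure of a linear section to be a morphism is an element of
`∏ₐ Hom_K(V(ta), W(ha))`, and writing it as a coboundary corrects the section. -/
theorem exists_section_of_surjective_coboundary {V : QuiverRep.{u, v, q, w₁} K Q}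
    {W : QuiverRep.{u, v, q, w₂} K Q} (h : Function.Surjective (coboundary V W))
    {E : QuiverRep.{u, v, q, w₃} K Q} {i : ∀ x, W.obj x →ₗ[K] E.obj x}
    {p : ∀ x, E.obj x →ₗ[K] V.obj x} (hi : i ∈ Hom W E) (hp : p ∈ Hom E V)
    (hinj : ∀ x, Function.Injective (i x)) (hsurj : ∀ x, Function.Surjective (p x))
    (hex : ∀ x, Function.Exact (i x) (p x)) :
    ∃ s ∈ Hom V E, ∀ x, p x ∘ₗ s x = LinearMap.id := by
  choose σ hσ using fun x => (p x).exists_rightInverse_of_surjective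
    (LinearMap.range_eq_top.2 (hsurj x))
  choose ρ hρ using fun x => (i x).exists_leftInverse_of_injective
    (LinearMap.ker_eq_bot.2 (hinj x))
  have hσ' : ∀ x m, p x (σ x m) = m := fun x m => LinearMap.congr_fun (hσ x) m
  have hρ' : ∀ x m, ρ x (i x m) = m := fun x m => LinearMap.congr_fun (hρ x) m
  obtain ⟨f, hf⟩ := h fun x y a => ρ y ∘ₗ (E.map a ∘ₗ σ x - σ y ∘ₗ V.map a)
  refine ⟨fun x => σ x + i x ∘ₗ f x, ?_, fun x => ?_⟩
  · intro x y a
    ext m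
    have h1 := LinearMap.congr_fun (congrFun (congrFun (congrFun hf x) y) a) m
    have h2 : p y (E.map a (σ x m) - σ y (V.map a m)) = 0 := by
      have := LinearMap.congr_fun (hp x y a) (σ x m)
      simp only [LinearMap.comp_apply] at this
      rw [map_sub, this, hσ', hσ', sub_self]
    obtain ⟨n, hn⟩ := (hex y _).1 h2
    have h3 := LinearMap.congr_fun (hi x y a) (f x m)
    simp only [coboundary, LinearMap.coe_mk, AddHom.coe_mk, LinearMap.sub_apply,
      LinearMap.comp_apply] at h1 h3
    rw [← hn, hρ'] at h1
    have h4 := congrArg (i y) h1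
    rw [map_sub, hn, h3] at h4
    simp only [LinearMap.comp_apply, LinearMap.add_apply, map_add]
    rw [sub_eq_iff_eq_add] at h4
    rw [h4]
    abel
  · ext m
    simp [hσ', (hex x).apply_apply_eq_zero]

theorem extOneVanishes_of_surjective_coboundary {V W : QuiverRep.{u, v, q, w} K Q}
    (h : Function.Surjective (coboundary V W)) : ExtOneVanishes V W :=
  fun _ _ hi _ hp hinj hsurj hex =>
    exists_section_of_surjective_coboundary h hi hp hinj hsurj hex

/-- `Ext¹_Q(-, Z)` is right exact: if it vanishes on `Y`, it vanishes on subrepresentations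
of `Y`. -/
theorem surjective_coboundary_of_injective {X : QuiverRep.{u, v, q, w₁} K Q}
    {Y : QuiverRep.{u, v, q, w₂} K Q} {Z : QuiverRep.{u, v, q, w₃} K Q}
    {f : ∀ x, X.obj x →ₗ[K] Y.obj x} (hf : f ∈ Hom X Y)
    (hinj : ∀ x, Function.Injective (f x)) (h : Function.Surjective (coboundary Y Z)) :
    Function.Surjective (coboundary X Z) := by
  intro g
  choose ρ hρ using fun x => (f x).exists_leftInverse_of_injective
    (LinearMap.ker_eq_bot.2 (hinj x))
  obtain ⟨k, hk⟩ := h fun x y a => g x y a ∘ₗ ρ x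
  refine ⟨fun x => k x ∘ₗ f x, ?_⟩
  funext x y a
  have h1 : k y ∘ₗ Y.map a - Z.map a ∘ₗ k x = g x y a ∘ₗ ρ x :=
    congrFun (congrFun (congrFun hk x) y) a
  change (k y ∘ₗ f y) ∘ₗ X.map a - Z.map a ∘ₗ (k x ∘ₗ f x) = g x y a
  rw [LinearMap.comp_assoc, hf x y a, ← LinearMap.comp_assoc, ← LinearMap.comp_assoc,
    ← LinearMap.sub_comp, h1, LinearMap.comp_assoc, hρ, LinearMap.comp_id]

/-- The subrepresentation `ker f`. -/
def ker {X : QuiverRep.{u, v, q, w₁} K Q} {Y : QuiverRep.{u, v, q, w₂} K Q}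
    {f : ∀ x, X.obj x →ₗ[K] Y.obj x} (hf : f ∈ Hom X Y) : QuiverRep.{u, v, q, w₁} K Q where
  obj x := LinearMap.ker (f x)
  map {x y} a := (X.map a).restrict fun m hm => by
    have := LinearMap.congr_fun (hf x y a) m
    simp only [LinearMap.comp_apply] at this
    rw [LinearMap.mem_ker] at hm ⊢
    rw [this, hm, map_zero]

/-- The subrepresentation `im f`. -/
def range {X : QuiverRep.{u, v, q, w₁} K Q} {Y : QuiverRep.{u, v, q, w₂} K Q}
    {f : ∀ x, X.obj x →ₗ[K] Y.obj x} (hf : f ∈ Hom X Y) : QuiverRep.{u, v, q, w₂} K Q where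
  obj x := LinearMap.range (f x)
  map {x y} a := (Y.map a).restrict fun m hm => by
    obtain ⟨n, rfl⟩ := hm
    exact ⟨X.map a n, LinearMap.congr_fun (hf x y a) n⟩

/-- A nonzero morphism from a brick `X` to an object `Y` on which all `Ext¹_Q(Y, -)` vanish is
injective: the epimorphism from `X` onto its image splits. -/
theorem injective_of_surjective_coboundary {X : QuiverRep.{u, v, q, w₁} K Q}
    {Y : QuiverRep.{u, v, q, w₂} K Q} (hX : Module.finrank K (Hom X X) = 1)
    (hY : ∀ Z : QuiverRep.{u, v, q, w₁} K Q, Function.Surjective (coboundary Y Z))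
    {f : ∀ x, X.obj x →ₗ[K] Y.obj x} (hf : f ∈ Hom X Y) (hne : f ≠ 0) (x : Q) :
    Function.Injective (f x) := by
  have hp : (fun x => (f x).rangeRestrict) ∈ Hom X (range hf) := by
    intro x y a
    refine LinearMap.ext fun m => ?_
    exact Subtype.ext (LinearMap.congr_fun (hf x y a) m)
  have hi : (fun x => (LinearMap.ker (f x)).subtype) ∈ Hom (ker hf) X := fun x y a => rfl
  have hj : (fun x => (LinearMap.range (f x)).subtype) ∈ Hom (range hf) Y := fun x y a => rfl
  obtain ⟨s, hs, hps⟩ := exists_section_of_surjective_coboundary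
    (surjective_coboundary_of_injective hj (fun x => Subtype.val_injective) (hY (ker hf)))
    hi hp (fun x => Subtype.val_injective) (fun x => (f x).surjective_rangeRestrict)
    (fun x => by
      intro m
      constructor
      · intro h
        exact ⟨⟨m, congrArg Subtype.val h⟩, rfl⟩
      · rintro ⟨n, rfl⟩
        exact Subtype.ext n.2)
  have hid : (fun _ => LinearMap.id) ∈ Hom X X := fun x y a => rfl
  have hsp := comp_mem_hom hs hp
  -- The identity is nonzero, so it spans the one-dimensional space `Hom X X`.
  have hid0 : (⟨_, hid⟩ : Hom X X) ≠ 0 := by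
    intro h
    apply hne
    funext x
    have : (LinearMap.id : X.obj x →ₗ[K] X.obj x) = 0 := congrFun (congrArg Subtype.val h) x
    rw [← LinearMap.comp_id (f x), this, LinearMap.comp_zero, Pi.zero_apply]
  obtain ⟨c, hc⟩ := (finrank_eq_one_iff_of_nonzero' _ hid0).1 hX ⟨_, hsp⟩
  have hc' : ∀ x m, s x ((f x).rangeRestrict m) = c • m := fun x m =>
    (LinearMap.congr_fun (congrFun (congrArg Subtype.val hc) x) m).symm
  have hc0 : c ≠ 0 := by
    rintro rfl
    apply hne
    funext x
    ext m
    have h1 : (f x).rangeRestrict (s x ((f x).rangeRestrict m)) = (f x).rangeRestrict m :=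
      LinearMap.congr_fun (hps x) ((f x).rangeRestrict m)
    rw [hc', zero_smul, map_zero] at h1
    exact (congrArg Subtype.val h1).symm
  intro m n hmn
  have h1 : (f x).rangeRestrict m = (f x).rangeRestrict n := Subtype.ext hmn
  have h2 := hc' x m
  rw [h1, hc'] at h2
  exact (smul_right_injective _ hc0 h2).symm

end QuiverRep

/-! ### The Euler form and its homological interpretation -/

section EulerForm

variable {Q : Type v} [Quiver.{q} Q] [Fintype Q] [∀ x y : Q, Fintype (x ⟶ y)]

theorem eulerForm_add_left (α α' β : Q → ℤ) :
    eulerForm (α + α') β = eulerForm α β + eulerForm α' β := by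
  simp only [eulerForm, Pi.add_apply, add_mul, Finset.sum_add_distrib]
  ring

theorem eulerForm_add_right (α β β' : Q → ℤ) :
    eulerForm α (β + β') = eulerForm α β + eulerForm α β' := by
  simp only [eulerForm, Pi.add_apply, mul_add, Finset.sum_add_distrib]
  ring

theorem eulerForm_smul_left (c : ℤ) (α β : Q → ℤ) :
    eulerForm (c • α) β = c * eulerForm α β := by
  simp only [eulerForm, Pi.smul_apply, smul_eq_mul, mul_assoc, mul_sub, Finset.mul_sum]

theorem eulerForm_smul_right (c : ℤ) (α β : Q → ℤ) :
    eulerForm α (c • β) = c * eulerForm α β := by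
  simp only [eulerForm, Pi.smul_apply, smul_eq_mul, mul_left_comm _ c, mul_sub, Finset.mul_sum]

/-- The Euler form as a bilinear form. -/
def eulerBilin : LinearMap.BilinForm ℤ (Q → ℤ) :=
  LinearMap.mk₂ ℤ eulerForm eulerForm_add_left eulerForm_smul_left eulerForm_add_right
    eulerForm_smul_right

theorem eulerBilin_apply (α β : Q → ℤ) : eulerBilin α β = eulerForm α β := rfl

end EulerForm

namespace QuiverRep

variable {K : Type u} [Field K] {Q : Type v} [Quiver.{q} Q]

section Finite

variable [Fintype Q] [∀ x y : Q, Fintype (x ⟶ y)]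

/-- The transpose of the coboundary map with respect to the trace pairings. -/
def coboundaryTranspose (X : QuiverRep.{u, v, q, w₁} K Q) (Z : QuiverRep.{u, v, q, w₂} K Q) :
    (∀ x y (_ : x ⟶ y), Z.obj y →ₗ[K] X.obj x) →ₗ[K] (∀ x, Z.obj x →ₗ[K] X.obj x) where
  toFun ψ := fun x =>
    ∑ y, ∑ a : y ⟶ x, X.map a ∘ₗ ψ y x a - ∑ y, ∑ a : x ⟶ y, ψ x y a ∘ₗ Z.map a
  map_add' ψ φ := by
    funext x
    simp only [Pi.add_apply, LinearMap.add_comp, LinearMap.comp_add, Finset.sum_add_distrib]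
    abel
  map_smul' c ψ := by
    funext x
    simp only [Pi.smul_apply, LinearMap.smul_comp, LinearMap.comp_smul, RingHom.id_apply, smul_sub,
      Finset.smul_sum]

/-- The dual of `Ext¹_Q(X, Z)`. It is realised, through the trace pairing between
`∏ₐ Hom_K(X(ta), Z(ha))` and `∏ₐ Hom_K(Z(ha), X(ta))`, as the annihilator of the coboundaries. -/
def DExt (X : QuiverRep.{u, v, q, w₁} K Q) (Z : QuiverRep.{u, v, q, w₂} K Q) :
    Submodule K (∀ x y (_ : x ⟶ y), Z.obj y →ₗ[K] X.obj x) :=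
  LinearMap.ker (coboundaryTranspose X Z)

theorem mem_DExt {X : QuiverRep.{u, v, q, w₁} K Q} {Z : QuiverRep.{u, v, q, w₂} K Q}
    {ψ : ∀ x y (_ : x ⟶ y), Z.obj y →ₗ[K] X.obj x} :
    ψ ∈ DExt X Z ↔ ∀ x (z : Z.obj x),
      ∑ y, ∑ a : y ⟶ x, X.map a (ψ y x a z) = ∑ y, ∑ a : x ⟶ y, ψ x y a (Z.map a z) := by
  rw [DExt, LinearMap.mem_ker, funext_iff]
  refine forall_congr' fun x => ?_
  rw [LinearMap.ext_iff]
  refine forall_congr' fun z => ?_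
  rw [← sub_eq_zero (b := ∑ y, ∑ a : x ⟶ y, ψ x y a (Z.map a z))]
  simp [coboundaryTranspose, LinearMap.sum_apply]

theorem eq_zero_of_trace_comp_eq_zero {M N : Type*} [AddCommGroup M] [Module K M]
    [Module.Finite K M] [AddCommGroup N] [Module K N] [Module.Finite K N] {h : N →ₗ[K] M}
    (H : ∀ f : M →ₗ[K] N, LinearMap.trace K M (h ∘ₗ f) = 0) : h = 0 := by
  ext z
  rw [LinearMap.zero_apply, ← Module.forall_dual_apply_eq_zero_iff K]
  intro ξ
  have h1 : h ∘ₗ ξ.smulRight z = ξ.smulRight (h z) := by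
    ext m
    simp
  rw [← LinearMap.trace_smulRight, ← h1]
  exact H _

/-- The trace pairing `(ψ, g) ↦ ∑ₐ tr(ψₐ gₐ)`. -/
noncomputable def arrowPairing (X : QuiverRep.{u, v, q, w₁} K Q)
    (Z : QuiverRep.{u, v, q, w₂} K Q) :
    (∀ x y (_ : x ⟶ y), Z.obj y →ₗ[K] X.obj x) →ₗ[K]
      Module.Dual K (∀ x y (_ : x ⟶ y), X.obj x →ₗ[K] Z.obj y) :=
  LinearMap.mk₂ K
    (fun ψ g => ∑ x, ∑ y, ∑ a : x ⟶ y, LinearMap.trace K (X.obj x) (ψ x y a ∘ₗ g x y a))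
    (by intros; simp only [Pi.add_apply, LinearMap.add_comp, map_add, Finset.sum_add_distrib])
    (by intros; simp only [Pi.smul_apply, LinearMap.smul_comp, map_smul, Finset.smul_sum])
    (by intros; simp only [Pi.add_apply, LinearMap.comp_add, map_add, Finset.sum_add_distrib])
    (by intros; simp only [Pi.smul_apply, LinearMap.comp_smul, map_smul, Finset.smul_sum])

theorem arrowPairing_apply (X : QuiverRep.{u, v, q, w₁} K Q) (Z : QuiverRep.{u, v, q, w₂} K Q)
    (ψ : ∀ x y (_ : x ⟶ y), Z.obj y →ₗ[K] X.obj x)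
    (g : ∀ x y (_ : x ⟶ y), X.obj x →ₗ[K] Z.obj y) :
    arrowPairing X Z ψ g =
      ∑ x, ∑ y, ∑ a : x ⟶ y, LinearMap.trace K (X.obj x) (ψ x y a ∘ₗ g x y a) := rfl

theorem arrowPairing_injective (X : QuiverRep.{u, v, q, w₁} K Q)
    (Z : QuiverRep.{u, v, q, w₂} K Q) : Function.Injective (arrowPairing X Z) := by
  classical
  rw [injective_iff_map_eq_zero]
  intro ψ hψ
  funext x y a
  refine eq_zero_of_trace_comp_eq_zero fun f => ?_
  have h := LinearMap.congr_fun hψ (Pi.single x (Pi.single y (Pi.single a f)))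
  rw [arrowPairing_apply, Finset.sum_eq_single x, Finset.sum_eq_single y,
    Finset.sum_eq_single a] at h
  · simpa using h
  · intro b _ hb
    simp [Pi.single_eq_of_ne hb]
  · simp
  · intro b _ hb
    simp [Pi.single_eq_of_ne hb]
  · simp
  · intro b _ hb
    simp [Pi.single_eq_of_ne hb]
  · simp

theorem finrank_arrowMaps (X : QuiverRep.{u, v, q, w₁} K Q) (Z : QuiverRep.{u, v, q, w₂} K Q) :
    Module.finrank K (∀ x y (_ : x ⟶ y), X.obj x →ₗ[K] Z.obj y) =
      ∑ x, ∑ y, ∑ _a : x ⟶ y, Module.finrank K (X.obj x) * Module.finrank K (Z.obj y) := by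
  simp only [Module.finrank_pi_fintype, Module.finrank_linearMap]

/-- The trace pairing as a linear equivalence. -/
noncomputable def arrowPairingEquiv (X : QuiverRep.{u, v, q, w₁} K Q)
    (Z : QuiverRep.{u, v, q, w₂} K Q) :
    (∀ x y (_ : x ⟶ y), Z.obj y →ₗ[K] X.obj x) ≃ₗ[K]
      Module.Dual K (∀ x y (_ : x ⟶ y), X.obj x →ₗ[K] Z.obj y) :=
  LinearEquiv.ofInjectiveOfFinrankEq (arrowPairing X Z) (arrowPairing_injective X Z) (by
    rw [Subspace.dual_finrank_eq, finrank_arrowMaps]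
    simp only [Module.finrank_pi_fintype, Module.finrank_linearMap, mul_comm])

theorem _root_.LinearMap.finset_sum_comp {ι M N P : Type*} [AddCommGroup M] [Module K M]
    [AddCommGroup N] [Module K N] [AddCommGroup P] [Module K P] (s : Finset ι)
    (g : ι → N →ₗ[K] P) (f : M →ₗ[K] N) : (∑ i ∈ s, g i) ∘ₗ f = ∑ i ∈ s, g i ∘ₗ f := by
  ext m
  simp [LinearMap.sum_apply]

theorem arrowPairing_coboundary (X : QuiverRep.{u, v, q, w₁} K Q)
    (Z : QuiverRep.{u, v, q, w₂} K Q) (ψ : ∀ x y (_ : x ⟶ y), Z.obj y →ₗ[K] X.obj x)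
    (f : ∀ x, X.obj x →ₗ[K] Z.obj x) :
    arrowPairing X Z ψ (coboundary X Z f) =
      ∑ x, LinearMap.trace K (X.obj x) (coboundaryTranspose X Z ψ x ∘ₗ f x) := by
  simp only [arrowPairing_apply, coboundary, coboundaryTranspose, LinearMap.coe_mk, AddHom.coe_mk,
    LinearMap.comp_sub, LinearMap.sub_comp, LinearMap.finset_sum_comp, map_sub, map_sum,
    Finset.sum_sub_distrib]
  congr 1
  rw [Finset.sum_comm]
  refine Finset.sum_congr rfl fun x _ => Finset.sum_congr rfl fun y _ =>
    Finset.sum_congr rfl fun a _ => ?_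
  rw [← LinearMap.comp_assoc, LinearMap.trace_comp_comm', LinearMap.comp_assoc]

/-- `DExt X Z` corresponds to the functionals that vanish on the coboundaries. -/
theorem DExt_eq_comap (X : QuiverRep.{u, v, q, w₁} K Q) (Z : QuiverRep.{u, v, q, w₂} K Q) :
    DExt X Z = (LinearMap.range (coboundary X Z)).dualAnnihilator.comap
      (arrowPairingEquiv X Z).toLinearMap := by
  classical
  ext ψ
  rw [Submodule.mem_comap, Submodule.mem_dualAnnihilator, DExt, LinearMap.mem_ker]
  have key : ∀ f, (arrowPairingEquiv X Z).toLinearMap ψ (coboundary X Z f) =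
      ∑ x, LinearMap.trace K (X.obj x) (coboundaryTranspose X Z ψ x ∘ₗ f x) :=
    arrowPairing_coboundary X Z ψ
  constructor
  · rintro h _ ⟨f, rfl⟩
    rw [key, h]
    simp
  · intro h
    funext x
    refine eq_zero_of_trace_comp_eq_zero fun f => ?_
    have h1 := h _ ⟨Pi.single x f, rfl⟩
    rw [key, Finset.sum_eq_single x] at h1
    · simpa using h1
    · intro b _ hb
      simp [Pi.single_eq_of_ne hb]
    · simp

theorem finrank_range_add_finrank_DExt (X : QuiverRep.{u, v, q, w₁} K Q)
    (Z : QuiverRep.{u, v, q, w₂} K Q) :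
    Module.finrank K (LinearMap.range (coboundary X Z)) + Module.finrank K (DExt X Z) =
      Module.finrank K (∀ x y (_ : x ⟶ y), X.obj x →ₗ[K] Z.obj y) := by
  rw [← Subspace.finrank_add_finrank_dualAnnihilator_eq (LinearMap.range (coboundary X Z)),
    DExt_eq_comap]
  congr 1
  exact ((arrowPairingEquiv X Z).submoduleMap _).finrank_eq.trans (by
    rw [Submodule.map_comap_eq_of_surjective (arrowPairingEquiv X Z).surjective])

theorem surjective_coboundary_iff (X : QuiverRep.{u, v, q, w₁} K Q)
    (Z : QuiverRep.{u, v, q, w₂} K Q) :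
    Function.Surjective (coboundary X Z) ↔ Module.finrank K (DExt X Z) = 0 := by
  have h := finrank_range_add_finrank_DExt X Z
  rw [← LinearMap.range_eq_top]
  constructor
  · intro h1
    rw [h1, finrank_top] at h
    omega
  · intro h1
    exact Submodule.eq_top_of_finrank_eq (by omega)

/-- `dim Hom_Q(X, Z) - dim Ext¹_Q(X, Z) = ⟨dim X, dim Z⟩`. -/
theorem finrank_hom_sub_finrank_DExt (X : QuiverRep.{u, v, q, w₁} K Q)
    (Z : QuiverRep.{u, v, q, w₂} K Q) :
    (Module.finrank K (Hom X Z) : ℤ) - Module.finrank K (DExt X Z) =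
      eulerForm X.dimVec Z.dimVec := by
  have h1 := LinearMap.finrank_range_add_finrank_ker (coboundary X Z)
  have h2 := finrank_range_add_finrank_DExt X Z
  rw [ker_coboundary] at h1
  rw [finrank_arrowMaps] at h2
  simp only [Module.finrank_pi_fintype, Module.finrank_linearMap] at h1
  zify at h1 h2
  unfold eulerForm dimVec
  linarith

theorem comp_mem_DExt {X : QuiverRep.{u, v, q, w₁} K Q} {Y : QuiverRep.{u, v, q, w₂} K Q}
    {Z : QuiverRep.{u, v, q, w₃} K Q} {f : ∀ x, Z.obj x →ₗ[K] Y.obj x} (hf : f ∈ Hom Z Y)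
    {ψ : ∀ x y (_ : x ⟶ y), Y.obj y →ₗ[K] X.obj x} (hψ : ψ ∈ DExt X Y) :
    (fun x y a => ψ x y a ∘ₗ f y) ∈ DExt X Z := by
  rw [mem_DExt] at hψ ⊢
  intro x z
  refine (hψ x (f x z)).trans ?_
  refine Finset.sum_congr rfl fun y _ => Finset.sum_congr rfl fun a _ => ?_
  exact congrArg (ψ x y a) (LinearMap.congr_fun (hf x y a) z).symm

/-- The map `DExt X Y → DExt X Z` induced by a morphism `Z → Y`. -/
def DExtMap (X : QuiverRep.{u, v, q, w₁} K Q) {Y : QuiverRep.{u, v, q, w₂} K Q}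
    {Z : QuiverRep.{u, v, q, w₃} K Q} {f : ∀ x, Z.obj x →ₗ[K] Y.obj x} (hf : f ∈ Hom Z Y) :
    DExt X Y →ₗ[K] DExt X Z where
  toFun ψ := ⟨fun x y a => ψ.1 x y a ∘ₗ f y, comp_mem_DExt hf ψ.2⟩
  map_add' _ _ := rfl
  map_smul' _ _ := rfl

end Finite

end QuiverRep

/-! ### Projective representations and the Auslander–Reiten translate -/

namespace QuiverRep

variable {K : Type u} [Field K] {Q : Type v} [Quiver.{q} Q]

/-- The action of a path. -/
def pathMap (Z : QuiverRep.{u, v, q, w} K Q) {y : Q} :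
    ∀ {x : Q}, Quiver.Path y x → (Z.obj y →ₗ[K] Z.obj x)
  | _, Quiver.Path.nil => LinearMap.id
  | _, Quiver.Path.cons p a => Z.map a ∘ₗ pathMap Z p

@[simp] theorem pathMap_nil (Z : QuiverRep.{u, v, q, w} K Q) (y : Q) :
    Z.pathMap (Quiver.Path.nil : Quiver.Path y y) = LinearMap.id := rfl

@[simp] theorem pathMap_cons (Z : QuiverRep.{u, v, q, w} K Q) {y x x' : Q} (p : Quiver.Path y x)
    (a : x ⟶ x') : Z.pathMap (p.cons a) = Z.map a ∘ₗ Z.pathMap p := rfl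

theorem pathMap_toPath_comp (Z : QuiverRep.{u, v, q, w} K Q) {y y' x : Q} (b : y ⟶ y')
    (p : Quiver.Path y' x) : Z.pathMap (b.toPath.comp p) = Z.pathMap p ∘ₗ Z.map b := by
  induction p with
  | nil => rfl
  | cons p a ih => rw [Quiver.Path.comp_cons, pathMap_cons, ih, pathMap_cons, LinearMap.comp_assoc]

theorem hom_pathMap {Z : QuiverRep.{u, v, q, w₁} K Q} {Y : QuiverRep.{u, v, q, w₂} K Q}
    {f : ∀ x, Z.obj x →ₗ[K] Y.obj x} (hf : f ∈ Hom Z Y) {y x : Q} (p : Quiver.Path y x)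
    (z : Z.obj y) : f x (Z.pathMap p z) = Y.pathMap p (f y z) := by
  induction p with
  | nil => rfl
  | cons p a ih =>
    rw [pathMap_cons, pathMap_cons, LinearMap.comp_apply, LinearMap.comp_apply, ← ih]
    exact LinearMap.congr_fun (hf _ _ a) _

variable (K) in
/-- The representation with zero maps and dimension vector `n`. -/
def ofDim (n : Q → ℕ) : QuiverRep.{u, v, q, u} K Q where
  obj x := Fin (n x) → K
  map _ := 0

theorem dimVec_ofDim (n : Q → ℕ) : (ofDim K n).dimVec = fun x => (n x : ℤ) := by
  funext x
  change ((Module.finrank K (Fin (n x) → K) : ℕ) : ℤ) = n x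
  simp

variable [∀ x y : Q, Finite (Quiver.Path x y)]

variable (K) in
/-- The indecomposable projective representation at the vertex `y`: its space at `x` has the paths
from `y` to `x` as a basis. -/
noncomputable def proj (y : Q) : QuiverRep.{u, v, q, max u v q} K Q where
  obj x := Quiver.Path y x →₀ K
  map a := Finsupp.lmapDomain K K fun p => p.cons a

/-- The vector of `proj K y` given by a path. -/
noncomputable def pathVec {y x : Q} (p : Quiver.Path y x) : (proj K y).obj x := Finsupp.single p 1

theorem proj_map_pathVec {y x x' : Q} (p : Quiver.Path y x) (a : x ⟶ x') :
    (proj K y).map a (pathVec p) = pathVec (p.cons a) :=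
  Finsupp.mapDomain_single

theorem proj_hom_ext {y x : Q} {M : Type*} [AddCommGroup M] [Module K M]
    {f g : (proj K y).obj x →ₗ[K] M} (h : ∀ p, f (pathVec p) = g (pathVec p)) : f = g :=
  Finsupp.lhom_ext' fun p => LinearMap.ext_ring (h p)

/-- The linear map out of `proj K y` at the vertex `x` with prescribed values on paths. -/
noncomputable def projLift {y x : Q} {M : Type*} [AddCommGroup M] [Module K M]
    (c : Quiver.Path y x → M) : (proj K y).obj x →ₗ[K] M :=
  Finsupp.linearCombination K c

@[simp] theorem projLift_pathVec {y x : Q} {M : Type*} [AddCommGroup M] [Module K M]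
    (c : Quiver.Path y x → M) (p : Quiver.Path y x) :
    projLift (K := K) c (pathVec p) = c p :=
  (Finsupp.linearCombination_single K 1 p).trans (one_smul K _)

/-- The morphism `proj K y → Z` with value `z` on the trivial path. -/
noncomputable def ofVec (Z : QuiverRep.{u, v, q, w} K Q) {y : Q} (z : Z.obj y) :
    ∀ x, (proj K y).obj x →ₗ[K] Z.obj x :=
  fun _ => projLift fun p => Z.pathMap p z

@[simp] theorem ofVec_pathVec (Z : QuiverRep.{u, v, q, w} K Q) {y x : Q} (z : Z.obj y)
    (p : Quiver.Path y x) : Z.ofVec z x (pathVec p) = Z.pathMap p z :=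
  projLift_pathVec _ p

theorem ofVec_mem (Z : QuiverRep.{u, v, q, w} K Q) {y : Q} (z : Z.obj y) :
    Z.ofVec z ∈ Hom (proj K y) Z := by
  intro x x' a
  refine proj_hom_ext fun p => ?_
  simp [proj_map_pathVec]

/-- `Hom_Q(P_y, Z) ≃ Z(y)`. -/
noncomputable def homProjEquiv (Z : QuiverRep.{u, v, q, w} K Q) (y : Q) :
    Hom (proj K y) Z ≃ₗ[K] Z.obj y where
  toFun f := f.1 y (pathVec Quiver.Path.nil)
  map_add' _ _ := rfl
  map_smul' _ _ := rfl
  invFun z := ⟨Z.ofVec z, Z.ofVec_mem z⟩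
  left_inv := by
    rintro ⟨f, hf⟩
    refine Subtype.ext (funext fun x => proj_hom_ext fun p => ?_)
    rw [ofVec_pathVec]
    induction p with
    | nil => rfl
    | cons p a ih =>
      rw [pathMap_cons, LinearMap.comp_apply, ih, ← proj_map_pathVec]
      exact (LinearMap.congr_fun (hf _ _ a) _).symm
  right_inv z := by simp

/-- The values on paths of a solution `f` of `coboundary f = g`, for `g` defined on `proj K y`. -/
noncomputable def pathPrimitive {Z : QuiverRep.{u, v, q, w} K Q} {y : Q}
    (g : ∀ x x' (_ : x ⟶ x'), (proj K y).obj x →ₗ[K] Z.obj x') :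
    ∀ {x : Q}, Quiver.Path y x → Z.obj x
  | _, Quiver.Path.nil => 0
  | _, Quiver.Path.cons p a => Z.map a (pathPrimitive g p) + g _ _ a (pathVec p)

/-- `Ext¹_Q(P_y, Z) = 0`. -/
theorem surjective_coboundary_proj (Z : QuiverRep.{u, v, q, w} K Q) (y : Q) :
    Function.Surjective (coboundary (proj K y) Z) := by
  intro g
  refine ⟨fun x => projLift fun p => pathPrimitive g p, ?_⟩
  funext x x' a
  refine proj_hom_ext fun p => ?_
  simp [coboundary, proj_map_pathVec, pathPrimitive]

theorem pathMap_proj_pathVec {y y' x : Q} (p : Quiver.Path y y') (r : Quiver.Path y' x) :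
    (proj K y).pathMap r (pathVec p) = pathVec (p.comp r) := by
  induction r with
  | nil => rfl
  | cons r a ih => rw [pathMap_cons, LinearMap.comp_apply, ih, proj_map_pathVec,
      Quiver.Path.comp_cons]

variable [Fintype Q] [∀ x y : Q, Fintype (x ⟶ y)]

/-- The Auslander–Reiten translate of `X`: its space at `y` is `D Ext¹_Q(X, P_y)`. -/
noncomputable def tau (X : QuiverRep.{u, v, q, w} K Q) :
    QuiverRep.{u, v, q, max u v q w} K Q where
  obj y := DExt X (proj K y)
  map {y _} b := DExtMap X (ofVec_mem (proj K y) (pathVec b.toPath))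

theorem tau_map_apply (X : QuiverRep.{u, v, q, w} K Q) {y y' : Q} (b : y ⟶ y')
    (ψ : (tau X).obj y) {x x' : Q} (a : x ⟶ x') (p : Quiver.Path y' x') :
    ((tau X).map b ψ).1 x x' a (pathVec p) = ψ.1 x x' a (pathVec (b.toPath.comp p)) := by
  change ψ.1 x x' a ((proj K y).ofVec (pathVec b.toPath) x' (pathVec p)) = _
  rw [ofVec_pathVec, pathMap_proj_pathVec]

theorem tau_pathMap_apply (X : QuiverRep.{u, v, q, w} K Q) {y y' : Q} (r : Quiver.Path y y')
    (ψ : (tau X).obj y) {x x' : Q} (a : x ⟶ x') (p : Quiver.Path y' x') :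
    ((tau X).pathMap r ψ).1 x x' a (pathVec p) = ψ.1 x x' a (pathVec (r.comp p)) := by
  induction r with
  | nil => rw [Quiver.Path.nil_comp]; rfl
  | cons r b ih =>
    rw [pathMap_cons, LinearMap.comp_apply, tau_map_apply, ih, ← Quiver.Path.comp_assoc]
    rfl

theorem tau_ext {X : QuiverRep.{u, v, q, w} K Q} {y : Q} {ψ φ : (tau X).obj y}
    (h : ∀ (x x' : Q) (a : x ⟶ x') (p : Quiver.Path y x'),
      ψ.1 x x' a (pathVec p) = φ.1 x x' a (pathVec p)) : ψ = φ :=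
  Subtype.ext (funext fun x => funext fun x' => funext fun a => proj_hom_ext (h x x' a))

/-- The Auslander–Reiten formula `D Ext¹_Q(X, Z) ≃ Hom_Q(Z, τX)`. A vector `z ∈ Z(y)` is a
morphism `P_y → Z`, along which an element of `D Ext¹_Q(X, Z)` is pulled back. -/
noncomputable def DExtEquivHomTau (X : QuiverRep.{u, v, q, w₁} K Q)
    (Z : QuiverRep.{u, v, q, w₂} K Q) : DExt X Z ≃ₗ[K] Hom Z (tau X) where
  toFun ψ := ⟨fun y =>
    { toFun := fun z => DExtMap X (Z.ofVec_mem z) ψ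
      map_add' := fun z z' => tau_ext fun x x' a p => by
        change ψ.1 x x' a (Z.ofVec (z + z') x' (pathVec p)) =
          ψ.1 x x' a (Z.ofVec z x' (pathVec p)) + ψ.1 x x' a (Z.ofVec z' x' (pathVec p))
        simp
      map_smul' := fun c z => tau_ext fun x x' a p => by
        change ψ.1 x x' a (Z.ofVec (c • z) x' (pathVec p)) =
          c • ψ.1 x x' a (Z.ofVec z x' (pathVec p))
        simp }, by
    intro y y' b
    refine LinearMap.ext fun z => tau_ext fun x x' a p => ?_
    refine Eq.trans ?_ (tau_map_apply X b _ a p).symm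
    change ψ.1 x x' a (Z.ofVec (Z.map b z) x' (pathVec p)) =
      ψ.1 x x' a (Z.ofVec z x' (pathVec (b.toPath.comp p)))
    simp [pathMap_toPath_comp]⟩
  map_add' _ _ := rfl
  map_smul' _ _ := rfl
  invFun g := ⟨fun x y a =>
    { toFun := fun z => (g.1 y z).1 x y a (pathVec Quiver.Path.nil)
      map_add' := fun z z' => by rw [map_add]; rfl
      map_smul' := fun c z => by rw [map_smul]; rfl }, by
    rw [mem_DExt]
    intro x z
    refine (mem_DExt.1 (g.1 x z).2 x (pathVec Quiver.Path.nil)).trans ?_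
    refine Finset.sum_congr rfl fun y _ => Finset.sum_congr rfl fun a _ => ?_
    have h : g.1 y (Z.map a z) = (tau X).map a (g.1 x z) := LinearMap.congr_fun (g.2 x y a) z
    change _ = (g.1 y (Z.map a z)).1 x y a (pathVec Quiver.Path.nil)
    rw [h, tau_map_apply, proj_map_pathVec]
    rfl⟩
  left_inv ψ := by
    refine Subtype.ext (funext fun x => funext fun y => funext fun a => LinearMap.ext fun z => ?_)
    change ψ.1 x y a (Z.ofVec z y (pathVec Quiver.Path.nil)) = _
    simp
  right_inv g := by
    refine Subtype.ext (funext fun y => LinearMap.ext fun z => tau_ext fun x x' a p => ?_)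
    change (g.1 x' (Z.ofVec z x' (pathVec p))).1 x x' a (pathVec Quiver.Path.nil) = _
    rw [ofVec_pathVec]
    rw [hom_pathMap g.2, tau_pathMap_apply, Quiver.Path.comp_nil]

theorem finrank_hom_tau (X : QuiverRep.{u, v, q, w₁} K Q) (Z : QuiverRep.{u, v, q, w₂} K Q) :
    Module.finrank K (Hom Z (tau X)) = Module.finrank K (DExt X Z) :=
  (DExtEquivHomTau X Z).finrank_eq.symm

theorem eulerForm_proj_left (Z : QuiverRep.{u, v, q, w} K Q) (y : Q) :
    eulerForm (proj K y).dimVec Z.dimVec = Z.dimVec y := by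
  rw [← finrank_hom_sub_finrank_DExt, (homProjEquiv Z y).finrank_eq,
    (surjective_coboundary_iff _ _).1 (surjective_coboundary_proj Z y)]
  simp [dimVec]

/-- The functional `⟨dim P_y, -⟩` is evaluation at `y`; every vector is a difference of dimension
vectors, so this follows from `eulerForm_proj_left`. -/
theorem eulerForm_proj_left' (z : Q → ℤ) (y : Q) : eulerForm (proj K y).dimVec z = z y := by
  have h : ∀ n : Q → ℕ, eulerForm (proj K y).dimVec (fun x => (n x : ℤ)) = n y := fun n => by
    rw [← dimVec_ofDim (K := K), eulerForm_proj_left, dimVec_ofDim]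
  have hz : z = (fun x => ((z x).toNat : ℤ)) + (-1 : ℤ) • (fun x => ((-z x).toNat : ℤ)) := by
    funext x
    simp only [Pi.add_apply, Pi.smul_apply, smul_eq_mul]
    omega
  conv_lhs => rw [hz]
  rw [eulerForm_add_right, eulerForm_smul_right, h, h]
  omega

/-- The dimension vectors of the projectives form the basis of `ℤ^{Q₀}` that is dual to the
standard basis with respect to the Euler form. -/
theorem eq_sum_eulerForm_smul_proj [DecidableEq Q] (z : Q → ℤ) :
    z = ∑ y, eulerForm z (Pi.single y 1) • (proj K y).dimVec := by
  let P : Matrix Q Q ℤ := fun y x => (proj K y).dimVec x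
  let E : Matrix Q Q ℤ := fun x y => eulerForm (Pi.single x 1) (Pi.single y 1)
  have hexp : ∀ (α β : Q → ℤ), eulerForm α β = ∑ x, α x * eulerForm (Pi.single x 1) β := by
    intro α β
    have h : α = ∑ x, α x • (Pi.single x 1 : Q → ℤ) := (Finset.univ_sum_single α).symm.trans
      (Finset.sum_congr rfl fun x _ => by rw [← Pi.single_smul, smul_eq_mul, mul_one])
    conv_lhs => rw [h, ← eulerBilin_apply, map_sum, LinearMap.sum_apply]
    refine Finset.sum_congr rfl fun x _ => ?_
    rw [map_smul, LinearMap.smul_apply, eulerBilin_apply, smul_eq_mul]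
  -- The bases are dual, so the two matrices are inverse to each other on either side.
  have hPE : P * E = 1 := by
    ext y x
    rw [Matrix.mul_apply, ← hexp (proj K y).dimVec, eulerForm_proj_left', Matrix.one_apply,
      Pi.single_apply]
  have hEP : E * P = 1 := mul_eq_one_comm.1 hPE
  funext x
  have h1 : Matrix.vecMul z (E * P) x = z x := by rw [hEP, Matrix.vecMul_one]
  rw [← h1, ← Matrix.vecMul_vecMul, Finset.sum_apply]
  refine Finset.sum_congr rfl fun y _ => ?_
  rw [Pi.smul_apply, smul_eq_mul, hexp z]
  rfl

/-- If `X` has no nonzero morphism to a projective, then `dim τX` is the Coxeter transform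
of `dim X`. -/
theorem eulerForm_tau_right {X : QuiverRep.{u, v, q, w} K Q}
    (hX : ∀ y, Hom X (proj K y) = ⊥) (z : Q → ℤ) :
    eulerForm z (tau X).dimVec = -eulerForm X.dimVec z := by
  classical
  have h : ∀ y, (tau X).dimVec y = -eulerForm X.dimVec (proj K y).dimVec := by
    intro y
    rw [← finrank_hom_sub_finrank_DExt, hX y, finrank_bot]
    simp [dimVec, tau]
    rfl
  conv_lhs => rw [eq_sum_eulerForm_smul_proj (K := K) z]
  conv_rhs => rw [eq_sum_eulerForm_smul_proj (K := K) z]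
  rw [← eulerBilin_apply, ← eulerBilin_apply, map_sum, map_sum, LinearMap.sum_apply,
    ← Finset.sum_neg_distrib]
  refine Finset.sum_congr rfl fun y _ => ?_
  rw [map_smul, map_smul, LinearMap.smul_apply, eulerBilin_apply, eulerBilin_apply,
    eulerForm_proj_left, h, smul_neg]

/-- Dual Auslander–Reiten formula: `dim Ext¹_Q(Z, τX) = dim Hom_Q(X, Z)`. It follows from the
formula for `Hom_Q(Z, τX)` by comparing Euler forms. -/
theorem finrank_DExt_tau {X : QuiverRep.{u, v, q, w₁} K Q}
    (hX : ∀ y, Hom X (proj K y) = ⊥) (Z : QuiverRep.{u, v, q, w₂} K Q) :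
    Module.finrank K (DExt Z (tau X)) = Module.finrank K (Hom X Z) := by
  have h1 := finrank_hom_sub_finrank_DExt Z (tau X)
  have h2 := finrank_hom_sub_finrank_DExt X Z
  rw [eulerForm_tau_right hX, finrank_hom_tau] at h1
  omega

/-- A brick is projective, or has no nonzero morphism to a projective. -/
theorem hom_proj_eq_bot_or {X : QuiverRep.{u, v, q, w₁} K Q}
    (hX : Module.finrank K (Hom X X) = 1) :
    (∀ y, Hom X (proj K y) = ⊥) ∨
      ∀ Z : QuiverRep.{u, v, q, w₂} K Q, Module.finrank K (DExt X Z) = 0 := by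
  rw [or_iff_not_imp_left]
  intro h Z
  push Not at h
  obtain ⟨y, hy⟩ := h
  obtain ⟨f, hf, hne⟩ := (Submodule.ne_bot_iff _).1 hy
  rw [← surjective_coboundary_iff]
  exact surjective_coboundary_of_injective hf
    (injective_of_surjective_coboundary hX (fun Z => surjective_coboundary_proj Z y) hf hne)
    (surjective_coboundary_proj Z y)

theorem finrank_hom_tau_self {X : QuiverRep.{u, v, q, w} K Q}
    (hX : Module.finrank K (Hom X X) = 1) (h : ∀ y, Hom X (proj K y) = ⊥) :
    Module.finrank K (Hom (tau X) (tau X)) = 1 := by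
  rw [finrank_hom_tau, finrank_DExt_tau h, hX]

end QuiverRep

/-! ### The Tits form of a Euclidean quiver -/

section Weight

variable {Q : Type v} [Quiver.{q} Q] [Fintype Q] [∀ x y : Q, Fintype (x ⟶ y)]

theorem eulerForm_eq_card (α β : Q → ℤ) :
    eulerForm α β = ∑ x, α x * β x - ∑ x, ∑ y, (Fintype.card (x ⟶ y) : ℤ) * (α x * β y) := by
  simp [eulerForm]

/-- A positive additive function `h` on a connected quiver: `2 h(x)` is the sum of the `h(y)` over
the neighbours `y` of `x`. Connectedness is expressed through functions that are constant along
arrows. -/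
structure IsAdditiveWeight (h : Q → ℤ) : Prop where
  pos : ∀ x, 0 < h x
  sum_eq : ∀ x, ∑ y, ((Fintype.card (x ⟶ y) : ℤ) + Fintype.card (y ⟶ x)) * h y = 2 * h x
  conn : ∀ β : Q → ℚ, (∀ x y, 0 < Fintype.card (x ⟶ y) → β x = β y) → ∀ x y, β x = β y

namespace IsAdditiveWeight

variable {h : Q → ℤ}

/-- The additive weight is in the radical of the Tits form. -/
theorem eulerForm_symm_eq_zero (H : IsAdditiveWeight h) (z : Q → ℤ) :
    eulerForm h z + eulerForm z h = 0 := by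
  have h1 : ∑ x, z x * (2 * h x) =
      ∑ x, ∑ y, (Fintype.card (x ⟶ y) : ℤ) * (h x * z y) +
        ∑ x, ∑ y, (Fintype.card (x ⟶ y) : ℤ) * (z x * h y) := by
    rw [Finset.sum_comm (f := fun x y => (Fintype.card (x ⟶ y) : ℤ) * (h x * z y)),
      ← Finset.sum_add_distrib]
    refine Finset.sum_congr rfl fun x _ => ?_
    rw [← H.sum_eq x, Finset.mul_sum, ← Finset.sum_add_distrib]
    refine Finset.sum_congr rfl fun y _ => ?_
    ring
  rw [eulerForm_eq_card, eulerForm_eq_card]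
  have h2 : ∑ x, z x * (2 * h x) = ∑ x, h x * z x + ∑ x, z x * h x := by
    rw [← Finset.sum_add_distrib]
    refine Finset.sum_congr rfl fun x _ => ?_
    ring
  linarith

/-- The Tits form as a sum of squares: `2 q(α) = ∑ₐ h(ta) h(ha) (α(ta)/h(ta) - α(ha)/h(ha))²`. -/
theorem two_mul_eulerForm (H : IsAdditiveWeight h) (α : Q → ℤ) :
    (2 * eulerForm α α : ℚ) = ∑ x, ∑ y, (Fintype.card (x ⟶ y) : ℚ) *
      (h x * h y * ((α x : ℚ) / h x - α y / h y) ^ 2) := by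
  have hne : ∀ x, (h x : ℚ) ≠ 0 := fun x => by exact_mod_cast (H.pos x).ne'
  have hsum : ∀ x, ∑ y, ((Fintype.card (x ⟶ y) : ℚ) + Fintype.card (y ⟶ x)) * h y = 2 * h x :=
    fun x => by exact_mod_cast H.sum_eq x
  have h1 : ∀ x y, (Fintype.card (x ⟶ y) : ℚ) *
      (h x * h y * ((α x : ℚ) / h x - α y / h y) ^ 2) =
      (α x : ℚ) ^ 2 / h x * (Fintype.card (x ⟶ y) * h y) +
      (α y : ℚ) ^ 2 / h y * (Fintype.card (x ⟶ y) * h x) -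
      2 * (Fintype.card (x ⟶ y) * (α x * α y)) := by
    intro x y
    have := hne x
    have := hne y
    field_simp
    ring
  simp_rw [h1, Finset.sum_sub_distrib, Finset.sum_add_distrib]
  rw [Finset.sum_comm (f := fun x y => (α y : ℚ) ^ 2 / h y * (Fintype.card (x ⟶ y) * h x)),
    ← Finset.sum_add_distrib]
  have h2 : ∀ x, ∑ y, (α x : ℚ) ^ 2 / h x * (Fintype.card (x ⟶ y) * h y) +
      ∑ y, (α x : ℚ) ^ 2 / h x * (Fintype.card (y ⟶ x) * h y) = 2 * (α x * α x) := by
    intro x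
    rw [← Finset.sum_add_distrib]
    simp_rw [← mul_add, ← add_mul]
    rw [← Finset.mul_sum, hsum]
    have := hne x
    field_simp
  simp_rw [h2, ← Finset.mul_sum]
  rw [eulerForm_eq_card]
  push_cast
  ring

theorem eulerForm_nonneg (H : IsAdditiveWeight h) (α : Q → ℤ) : 0 ≤ eulerForm α α := by
  have h1 := H.two_mul_eulerForm α
  have h2 : (0 : ℚ) ≤ ∑ x, ∑ y, (Fintype.card (x ⟶ y) : ℚ) *
      (h x * h y * ((α x : ℚ) / h x - α y / h y) ^ 2) := by
    refine Finset.sum_nonneg fun x _ => Finset.sum_nonneg fun y _ => ?_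
    have hx : (0 : ℚ) < h x := by exact_mod_cast H.pos x
    have hy : (0 : ℚ) < h y := by exact_mod_cast H.pos y
    positivity
  rw [← h1] at h2
  have h3 : (0 : ℚ) ≤ eulerForm α α := by linarith
  exact_mod_cast h3

theorem exists_eq_mul_of_eulerForm_eq_zero (H : IsAdditiveWeight h) {α : Q → ℤ}
    (hα : eulerForm α α = 0) :
    ∃ c : ℚ, ∀ x, (α x : ℚ) = c * h x := by
  have hpos : ∀ x, (0 : ℚ) < h x := fun x => by exact_mod_cast H.pos x
  have h1 := H.two_mul_eulerForm α
  rw [hα, Int.cast_zero, mul_zero, eq_comm, Finset.sum_eq_zero_iff_of_nonneg] at h1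
  · have h2 := H.conn (fun x => (α x : ℚ) / h x) fun x y hxy => by
      have h3 := h1 x (Finset.mem_univ x)
      rw [Finset.sum_eq_zero_iff_of_nonneg] at h3
      · have h4 := h3 y (Finset.mem_univ y)
        have h5 : (Fintype.card (x ⟶ y) : ℚ) ≠ 0 := by exact_mod_cast hxy.ne'
        have h6 := (hpos x).ne'
        have h7 := (hpos y).ne'
        simp only [mul_eq_zero, h5, h6, h7, false_or, or_self, pow_eq_zero_iff, ne_eq,
          OfNat.ofNat_ne_zero, not_false_eq_true] at h4
        exact sub_eq_zero.1 h4
      · intro y _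
        have := hpos x
        have := hpos y
        positivity
    rcases isEmpty_or_nonempty Q with hQ | ⟨⟨x₀⟩⟩
    · exact ⟨0, fun x => hQ.elim x⟩
    · refine ⟨(α x₀ : ℚ) / h x₀, fun x => ?_⟩
      rw [h2 x₀ x, div_mul_cancel₀ _ (hpos x).ne']
  · intro x _
    refine Finset.sum_nonneg fun y _ => ?_
    have := hpos x
    have := hpos y
    positivity

end IsAdditiveWeight

end Weight

namespace EuclideanGraph

/-- The minimal positive additive function on each Euclidean graph. -/
def weight : EuclideanGraph → ℕ → ℤ
  | A _, _ => 1
  | D n, i => if i ≤ 1 ∨ n + 3 ≤ i then 1 else 2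
  | E6, i => [1, 2, 3, 2, 1, 2, 1].getD i 1
  | E7, i => [1, 2, 3, 4, 3, 2, 1, 2].getD i 1
  | E8, i => [2, 4, 6, 5, 4, 3, 2, 1, 3].getD i 1

theorem weight_pos (t : EuclideanGraph) (i : Fin t.numVertices) : 0 < t.weight i := by
  cases t with
  | A n => exact one_pos
  | D n =>
    change 0 < (if _ then 1 else 2 : ℤ)
    split_ifs <;> norm_num
  | E6 => revert i; decide
  | E7 => revert i; decide
  | E8 => revert i; decide

theorem sum_numEdges_A (n : ℕ) (i : Fin (n + 2)) :
    ∑ j : Fin (n + 2), ((A n).numEdges i j : ℤ) = 2 := by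
  have h1 : ∀ i j : Fin (n + 2), (A n).edge i j = decide (j = i + 1) := by
    intro i j
    simp only [edge, Fin.ext_iff, Fin.val_add, Fin.val_one]
  have h2 : ∀ j : Fin (n + 2), (i = j + 1) ↔ (j = i - 1) := fun j => by
    rw [eq_sub_iff_add_eq, eq_comm]
  simp [numEdges, h1, h2, Finset.sum_add_distrib, Bool.toNat, Bool.cond_decide]

theorem sum_numEdges_D (n : ℕ) (i : Fin (n + 5)) :
    ∑ j : Fin (n + 5), ((D n).numEdges i j : ℤ) * (D n).weight j = 2 * (D n).weight i := by
  have h1 : ∀ i j : ℕ, i < n + 5 → j < n + 5 → ((D n).numEdges i j : ℤ) =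
      (if j = i + 1 then if 1 ≤ i ∧ i ≤ n + 2 then 1 else 0 else 0) +
      (if j = 2 then if i = 0 then 1 else 0 else 0) +
      (if j = n + 4 then if i = n + 2 then 1 else 0 else 0) +
      (if j = i - 1 then if 2 ≤ i ∧ i ≤ n + 3 then 1 else 0 else 0) +
      (if j = 0 then if i = 2 then 1 else 0 else 0) +
      (if j = n + 2 then if i = n + 4 then 1 else 0 else 0) := by
    intro i j hi hj
    simp only [numEdges, edge, Bool.toNat, Bool.cond_decide]
    grind
  have hi := i.2
  rw [Fin.sum_univ_eq_sum_range fun j => ((D n).numEdges i j : ℤ) * (D n).weight j,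
    Finset.sum_congr rfl fun j hj => by rw [h1 i j hi (Finset.mem_range.1 hj)]]
  simp only [add_mul, ite_mul, zero_mul, one_mul, Finset.sum_add_distrib, Finset.sum_ite_eq',
    Finset.mem_range]
  simp only [weight]
  generalize (i : ℕ) = k at *
  grind

theorem sum_numEdges_mul_weight (t : EuclideanGraph) (i : Fin t.numVertices) :
    ∑ j : Fin t.numVertices, (t.numEdges i j : ℤ) * t.weight j = 2 * t.weight i := by
  cases t with
  | A n =>
    simp only [weight, mul_one]
    exact sum_numEdges_A n i
  | D n => exact sum_numEdges_D n i
  | E6 => revert i; decide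
  | E7 => revert i; decide
  | E8 => revert i; decide

/-- Euclidean graphs are connected: a function that is constant along the edges is constant. -/
theorem eq_at_zero_of_edge (t : EuclideanGraph) {β : ℕ → ℚ}
    (hβ : ∀ i j, i < t.numVertices → j < t.numVertices → t.edge i j = true → β i = β j) :
    ∀ i < t.numVertices, β i = β 0 := by
  cases t with
  | A n =>
    intro i hi
    induction i with
    | zero => rfl
    | succ i ih =>
      rw [← ih (Nat.lt_of_succ_lt hi)]
      refine (hβ i (i + 1) (Nat.lt_of_succ_lt hi) hi ?_).symm
      simp only [numVertices] at hi
      simp [edge, Nat.mod_eq_of_lt hi]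
  | D n =>
    simp only [numVertices, edge, decide_eq_true_eq] at hβ ⊢
    have h02 : β 0 = β 2 := hβ 0 2 (by omega) (by omega) (by omega)
    have h12 : β 1 = β 2 := hβ 1 2 (by omega) (by omega) (by omega)
    have hp : ∀ k, k ≤ n + 1 → β (k + 2) = β 0 := by
      intro k hk
      induction k with
      | zero => exact h02.symm
      | succ k ih =>
        rw [← ih (by omega)]
        exact (hβ (k + 2) (k + 3) (by omega) (by omega) (by omega)).symm
    intro i hi
    rcases Nat.lt_or_ge i 2 with h | h
    · interval_cases i
      · rfl
      · rw [h12, h02]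
    · rcases Nat.lt_or_ge i (n + 4) with h' | h'
      · obtain ⟨k, rfl⟩ := Nat.exists_eq_add_of_le' h
        exact hp k (by omega)
      · obtain rfl : i = n + 4 := by omega
        rw [← hβ (n + 2) (n + 4) (by omega) (by omega) (by omega)]
        exact hp n (by omega)
  | E6 =>
    simp only [numVertices] at hβ ⊢
    have h0 := hβ 0 1 (by decide) (by decide) rfl
    have h1 := hβ 1 2 (by decide) (by decide) rfl
    have h2 := hβ 2 3 (by decide) (by decide) rfl
    have h3 := hβ 3 4 (by decide) (by decide) rfl
    have h4 := hβ 2 5 (by decide) (by decide) rfl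
    have h5 := hβ 5 6 (by decide) (by decide) rfl
    intro i hi
    interval_cases i <;> linarith
  | E7 =>
    simp only [numVertices] at hβ ⊢
    have h0 := hβ 0 1 (by decide) (by decide) rfl
    have h1 := hβ 1 2 (by decide) (by decide) rfl
    have h2 := hβ 2 3 (by decide) (by decide) rfl
    have h3 := hβ 3 4 (by decide) (by decide) rfl
    have h4 := hβ 4 5 (by decide) (by decide) rfl
    have h5 := hβ 5 6 (by decide) (by decide) rfl
    have h6 := hβ 3 7 (by decide) (by decide) rfl
    intro i hi
    interval_cases i <;> linarith
  | E8 =>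
    simp only [numVertices] at hβ ⊢
    have h0 := hβ 0 1 (by decide) (by decide) rfl
    have h1 := hβ 1 2 (by decide) (by decide) rfl
    have h2 := hβ 2 3 (by decide) (by decide) rfl
    have h3 := hβ 3 4 (by decide) (by decide) rfl
    have h4 := hβ 4 5 (by decide) (by decide) rfl
    have h5 := hβ 5 6 (by decide) (by decide) rfl
    have h6 := hβ 6 7 (by decide) (by decide) rfl
    have h7 := hβ 2 8 (by decide) (by decide) rfl
    intro i hi
    interval_cases i <;> linarith

end EuclideanGraph

theorem IsEuclideanQuiver.exists_isAdditiveWeight {Q : Type v} [Quiver.{q} Q] [Fintype Q]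
    [∀ x y : Q, Fintype (x ⟶ y)] (hQ : IsEuclideanQuiver Q) :
    ∃ h : Q → ℤ, IsAdditiveWeight h := by
  obtain ⟨-, t, e, he⟩ := hQ
  refine ⟨fun x => t.weight (e x), fun x => t.weight_pos (e x), fun x => ?_, fun β hβ => ?_⟩
  · rw [← t.sum_numEdges_mul_weight (e x), ← e.sum_comp]
    refine Finset.sum_congr rfl fun y _ => ?_
    rw [← he]
    push_cast
    rfl
  · have hN : ∀ x y, 0 < t.numEdges (e x) (e y) → β x = β y := by
      intro x y hxy
      rw [← he] at hxy
      rcases Nat.eq_zero_or_pos (Fintype.card (x ⟶ y)) with h0 | h0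
      · exact (hβ y x (by omega)).symm
      · exact hβ x y h0
    have h0 := t.eq_at_zero_of_edge
      (β := fun i => if hi : i < t.numVertices then β (e.symm ⟨i, hi⟩) else 0) (by
        intro i j hi hj hij
        simp only [hi, hj, dif_pos]
        apply hN
        simp [EuclideanGraph.numEdges, hij])
    have h1 : ∀ x, β x = _ := fun x => by
      have := h0 (e x) (e x).2
      simpa using this
    intro x y
    rw [h1 x, h1 y]

theorem IsEuclideanQuiver.finite_path {Q : Type v} [Quiver.{q} Q] [Fintype Q]
    [∀ x y : Q, Fintype (x ⟶ y)] (hQ : IsEuclideanQuiver Q) (x y : Q) :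
    Finite (Quiver.Path x y) := by
  classical
  -- Induction on the number of vertices from which `y` can be reached.
  induction hn : (Finset.univ.filter fun z : Q => Nonempty (Quiver.Path z y)).card
    using Nat.strong_induction_on generalizing y with
  | _ n ih =>
    have hlt : ∀ z (a : z ⟶ y), Finite (Quiver.Path x z) := by
      intro z a
      refine ih _ ?_ z rfl
      rw [← hn]
      refine Finset.card_lt_card (Finset.ssubset_iff_subset_ne.2 ⟨?_, ?_⟩)
      · intro z' hz'
        simp only [Finset.mem_filter, Finset.mem_univ, true_and] at hz' ⊢
        exact hz'.map fun p => p.cons a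
      · intro heq
        have hy : y ∈ Finset.univ.filter fun z : Q => Nonempty (Quiver.Path z y) := by
          simpa using ⟨Quiver.Path.nil⟩
        rw [← heq] at hy
        simp only [Finset.mem_filter, Finset.mem_univ, true_and] at hy
        obtain ⟨p⟩ := hy
        exact Quiver.Path.cons_ne_nil p a (hQ.1 y _)
    have : ∀ s : Σ z, (z ⟶ y), Finite (Quiver.Path x s.1) := fun s => hlt s.1 s.2
    by_cases hxy : x = y
    · subst hxy
      rw [(Set.finite_univ_iff (α := Quiver.Path x x)).symm]
      exact (Set.finite_singleton Quiver.Path.nil).subset fun p _ => hQ.1 x p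
    · refine Finite.of_surjective
        (fun s : (Σ s : (Σ z, (z ⟶ y)), Quiver.Path x s.1) => s.2.cons s.1.2) fun p => ?_
      cases p with
      | nil => exact absurd rfl hxy
      | cons p a => exact ⟨⟨⟨_, a⟩, p⟩, rfl⟩

/-! ### Coxeter orbits -/

namespace IsAdditiveWeight

variable {Q : Type v} [Quiver.{q} Q] [Fintype Q] [∀ x y : Q, Fintype (x ⟶ y)] {h : Q → ℤ}

/-- The radical of the Tits form is spanned, over `ℚ`, by the additive weight. -/
theorem exists_smul_eq_smul (H : IsAdditiveWeight h) {α : Q → ℤ} (hα : eulerForm α α ≤ 0) :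
    ∃ n m : ℤ, 0 < n ∧ n • α = m • h := by
  obtain ⟨c, hc⟩ := H.exists_eq_mul_of_eulerForm_eq_zero (le_antisymm hα (H.eulerForm_nonneg α))
  refine ⟨c.den, c.num, by exact_mod_cast c.den_pos, funext fun x => ?_⟩
  have h1 : (c.den : ℚ) * α x = c.num * h x := by
    rw [hc x, ← mul_assoc, mul_comm (c.den : ℚ), Rat.mul_den_eq_num]
  simp only [Pi.smul_apply, smul_eq_mul]
  exact_mod_cast h1

theorem eulerForm_self_eq_zero (H : IsAdditiveWeight h) : eulerForm h h = 0 := by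
  have := H.eulerForm_symm_eq_zero h
  omega

/-- A vector of nonzero defect is not in the radical, so the Tits form is positive on it. -/
theorem eulerForm_pos (H : IsAdditiveWeight h) {α : Q → ℤ} (hα : eulerForm h α ≠ 0) :
    0 < eulerForm α α := by
  by_contra hle
  obtain ⟨n, m, hn, hnm⟩ := H.exists_smul_eq_smul (not_lt.1 hle)
  have h1 : n * eulerForm h α = 0 := by
    rw [← eulerForm_smul_right, hnm, eulerForm_smul_right, H.eulerForm_self_eq_zero, mul_zero]
  rcases mul_eq_zero.1 h1 with h2 | h2
  · omega
  · exact hα h2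

/-- A weak form of the Cauchy–Schwarz inequality, obtained from `q(α ± β) ≥ 0`. -/
theorem abs_eulerForm_symm_le (H : IsAdditiveWeight h) (α β : Q → ℤ) :
    |eulerForm α β + eulerForm β α| ≤ eulerForm α α + eulerForm β β := by
  have h1 := H.eulerForm_nonneg (α + β)
  have h2 := H.eulerForm_nonneg (α + (-1 : ℤ) • β)
  simp only [eulerForm_add_left, eulerForm_add_right, eulerForm_smul_left,
    eulerForm_smul_right] at h1 h2
  rw [abs_le]
  constructor <;> linarith

/-- There is no infinite orbit of the Coxeter transformation inside the nonnegative vectors of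
negative defect and Tits form `1`. Modulo the radical such vectors form a finite set, so the orbit
returns to itself up to a multiple `D` of `h`, which may be taken nonnegative since the orbit is
bounded below. If `s` is the sum of the orbit between the two times, then
`⟨s, D⟩ = -2 q(s) ≤ 0`, whereas `⟨s, h⟩ = -⟨h, s⟩ > 0`. -/
theorem not_coxeter_orbit (H : IsAdditiveWeight h) {p : ℕ → Q → ℤ} (hp : ∀ k x, 0 ≤ p k x)
    (hq : ∀ k, eulerForm (p k) (p k) = 1) (hdef : ∀ k, eulerForm h (p k) < 0)
    (hcox : ∀ k z, eulerForm z (p (k + 1)) = -eulerForm (p k) z) : False := by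
  classical
  have hQ : Nonempty Q := by
    by_contra hne
    rw [not_nonempty_iff] at hne
    have := hdef 0
    simp [eulerForm] at this
  obtain ⟨x₀⟩ := hQ
  -- The classes modulo the radical are told apart by the symmetrised pairings with the unit
  -- vectors, which are bounded along the orbit.
  let b : Q → ℤ := fun x => 1 + eulerForm (Pi.single x 1 : Q → ℤ) (Pi.single x 1)
  let F : ℕ → ∀ x, Set.Icc (-b x) (b x) := fun k x =>
    ⟨eulerForm (p k) (Pi.single x 1) + eulerForm (Pi.single x 1) (p k), by
      have := H.abs_eulerForm_symm_le (p k) (Pi.single x 1)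
      rw [hq] at this
      exact abs_le.1 this⟩
  obtain ⟨y, hy⟩ := Finite.exists_infinite_fiber F
  have hy' : (F ⁻¹' {y}).Infinite := Set.infinite_coe_iff.1 hy
  -- Two times in the same fibre; the first minimises one coordinate of the orbit on that fibre.
  obtain ⟨k, hk, hmin⟩ := (measure fun k => (p k x₀).toNat).wf.has_min _ hy'.nonempty
  obtain ⟨l, hl, hkl⟩ := hy'.exists_gt k
  obtain ⟨D, hD⟩ : ∃ D, D = p l - p k := ⟨_, rfl⟩
  have hD0 : 0 ≤ D x₀ := by
    have h1 : ¬ (p l x₀).toNat < (p k x₀).toNat := hmin l hl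
    have h2 := hp k x₀
    have h3 := hp l x₀
    rw [hD, Pi.sub_apply]
    omega
  have hrad : eulerForm D D = 0 := by
    have h1 : eulerBilin D + eulerBilin.flip D = 0 := by
      refine LinearMap.pi_ext' fun x => LinearMap.ext_ring ?_
      have h2 := congrArg Subtype.val (congrFun (hk.trans hl.symm : F k = F l) x)
      simp only [F, ← eulerBilin_apply] at h2
      simp only [LinearMap.comp_apply, LinearMap.single_apply, LinearMap.add_apply,
        LinearMap.BilinForm.flip_apply, LinearMap.zero_apply, hD, map_sub, LinearMap.sub_apply]
      linarith
    have h2 := LinearMap.congr_fun h1 D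
    simp only [LinearMap.add_apply, LinearMap.BilinForm.flip_apply, LinearMap.zero_apply,
      eulerBilin_apply] at h2
    omega
  obtain ⟨n, m, hn, hnm⟩ := H.exists_smul_eq_smul hrad.le
  have hm : 0 ≤ m := by
    have h1 : n * D x₀ = m * h x₀ := congrFun hnm x₀
    have h2 : 0 ≤ m * h x₀ := h1 ▸ mul_nonneg hn.le hD0
    exact nonneg_of_mul_nonneg_left h2 (H.pos x₀)
  obtain ⟨s, hs⟩ : ∃ s, s = ∑ j ∈ Finset.Ico k l, p j := ⟨_, rfl⟩
  have hsdef : eulerForm h s < 0 := by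
    rw [hs, ← eulerBilin_apply, map_sum]
    exact Finset.sum_neg (fun j _ => hdef j) (Finset.nonempty_Ico.2 hkl)
  have hsh : 0 < eulerForm s h := by
    have := H.eulerForm_symm_eq_zero s
    omega
  have hsD : eulerForm s D = -(2 * eulerForm s s) := by
    have h1 : ∀ z, eulerForm z D = -(eulerForm s z + eulerForm z s) := by
      intro z
      have h2 : D = ∑ j ∈ Finset.Ico k l, (p (j + 1) - p j) := by
        rw [hD, Finset.sum_Ico_sub p hkl.le]
      rw [h2, hs, ← eulerBilin_apply, ← eulerBilin_apply, ← eulerBilin_apply, map_sum, map_sum,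
        map_sum, LinearMap.sum_apply, ← Finset.sum_add_distrib, ← Finset.sum_neg_distrib]
      refine Finset.sum_congr rfl fun j _ => ?_
      rw [map_sub, eulerBilin_apply, eulerBilin_apply, eulerBilin_apply, hcox]
      ring
    rw [h1]
    ring
  have h1 : n * eulerForm s D = m * eulerForm s h := by
    rw [← eulerForm_smul_right, hnm, eulerForm_smul_right]
  have h2 : 0 < eulerForm s s := H.eulerForm_pos hsdef.ne
  have h3 : n * eulerForm s D < 0 := mul_neg_of_pos_of_neg hn (by omega)
  exact absurd h3 (not_lt.2 (h1 ▸ mul_nonneg hm hsh.le))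

end IsAdditiveWeight

/-! ### Enumerations -/

theorem exists_list_pairwise {ι : Type*} [DecidableEq ι] {ok : ι → ι → Prop}
    (hok : ∀ A : Finset ι, A.Nonempty → ∃ i ∈ A, ∀ j ∈ A, j ≠ i → ok i j) (A : Finset ι) :
    ∃ l : List ι, l.Nodup ∧ (∀ i, i ∈ l ↔ i ∈ A) ∧ l.Pairwise ok := by
  induction A using Finset.strongInduction with
  | H A ih =>
    rcases A.eq_empty_or_nonempty with rfl | hA
    · exact ⟨[], List.nodup_nil, by simp, List.Pairwise.nil⟩
    · obtain ⟨i, hi, hij⟩ := hok A hA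
      obtain ⟨l, hl, hmem, hpw⟩ := ih (A.erase i) (Finset.erase_ssubset hi)
      refine ⟨i :: l, ?_, fun j => ?_, ?_⟩
      · rw [List.nodup_cons]
        exact ⟨fun h => by simp [hmem] at h, hl⟩
      · rw [List.mem_cons, hmem, Finset.mem_erase]
        by_cases hji : j = i
        · simp [hji, hi]
        · simp [hji]
      · rw [List.pairwise_cons]
        refine ⟨fun j hj => ?_, hpw⟩
        rw [hmem, Finset.mem_erase] at hj
        exact hij j hj.2 hj.1

/-- If every nonempty subset has an element that may precede all its other elements, then there
is an enumeration in which each element may precede all the later ones. -/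
theorem exists_perm_of_exists_first {r : ℕ} {ok : Fin r → Fin r → Prop}
    (hok : ∀ A : Finset (Fin r), A.Nonempty → ∃ i ∈ A, ∀ j ∈ A, j ≠ i → ok i j) :
    ∃ σ : Equiv.Perm (Fin r), ∀ i j, i < j → ok (σ i) (σ j) := by
  obtain ⟨l, hl, hmem, hpw⟩ := exists_list_pairwise hok Finset.univ
  have hall : ∀ i, i ∈ l := fun i => (hmem i).2 (Finset.mem_univ i)
  have hlen : l.length = r := by
    rw [← List.toFinset_card_of_nodup hl, show l.toFinset = Finset.univ by ext; simp [hall],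
      Finset.card_univ, Fintype.card_fin]
  refine ⟨(finCongr hlen.symm).trans (hl.getEquivOfForallMemList l hall), fun i j hij => ?_⟩
  rw [List.pairwise_iff_get] at hpw
  exact hpw _ _ hij

/-! ### Bricks and their defects -/

namespace QuiverRep

variable {K : Type u} [Field K] {Q : Type v} [Quiver.{q} Q]

theorem IsSchur.finrank_hom_self {V : QuiverRep.{u, v, q, w} K Q} (hV : V.IsSchur) :
    Module.finrank K (Hom V V) = 1 := by
  obtain ⟨e⟩ := hV
  have h : Subalgebra.toSubmodule V.End = Hom V V := rfl
  rw [← h]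
  exact e.toLinearEquiv.finrank_eq.trans (Module.finrank_self K)

/-- The endomorphisms of a brick are the scalars. -/
theorem exists_smul_of_mem_hom_self {V : QuiverRep.{u, v, q, w} K Q}
    (hV : Module.finrank K (Hom V V) = 1) {f : ∀ x, V.obj x →ₗ[K] V.obj x} (hf : f ∈ Hom V V) :
    ∃ c : K, ∀ x m, f x m = c • m := by
  have hid : (fun _ => LinearMap.id) ∈ Hom V V := fun x y a => rfl
  by_cases h0 : (⟨_, hid⟩ : Hom V V) = 0
  · refine ⟨0, fun x m => ?_⟩
    have h1 : (LinearMap.id : V.obj x →ₗ[K] V.obj x) = 0 := congrFun (congrArg Subtype.val h0) x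
    have h2 : m = 0 := LinearMap.congr_fun h1 m
    rw [h2, map_zero, smul_zero]
  · obtain ⟨c, hc⟩ := (finrank_eq_one_iff_of_nonzero' _ h0).1 hV ⟨_, hf⟩
    exact ⟨c, fun x m => (LinearMap.congr_fun (congrFun (congrArg Subtype.val hc) x) m).symm⟩

theorem not_isZero_of_finrank_hom_self {V : QuiverRep.{u, v, q, w} K Q}
    (hV : Module.finrank K (Hom V V) = 1) : ¬ V.IsZero := by
  intro h
  have : ∀ x, Subsingleton (V.obj x) := h
  have : Subsingleton (Hom V V) := ⟨fun f g => Subtype.ext (funext fun x =>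
    LinearMap.ext fun m => Subsingleton.elim _ _)⟩
  rw [Module.finrank_zero_of_subsingleton] at hV
  exact zero_ne_one hV

theorem isIndecomposable_of_finrank_hom_self {V : QuiverRep.{u, v, q, w} K Q}
    (hV : Module.finrank K (Hom V V) = 1) : V.IsIndecomposable := by
  refine ⟨not_isZero_of_finrank_hom_self hV, fun A B hAB => ?_⟩
  obtain ⟨f, hf, hbij⟩ := hAB
  let F : ∀ x, V.obj x ≃ₗ[K] (A.obj x × B.obj x) := fun x =>
    LinearEquiv.ofBijective (f x) (hbij x)
  have hFa : ∀ {x y : Q} (a : x ⟶ y) m, F y (V.map a m) = (A.map a (F x m).1, B.map a (F x m).2) :=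
    fun {x y} a m => LinearMap.congr_fun (hf x y a) m
  -- The projection to `A` is an endomorphism of `V`, hence a scalar.
  obtain ⟨c, hc⟩ := exists_smul_of_mem_hom_self hV
    (f := fun x => (F x).symm.toLinearMap ∘ₗ LinearMap.inl K _ _ ∘ₗ LinearMap.fst K _ _ ∘ₗ
      (F x).toLinearMap) (by
    intro x y a
    ext m
    apply (F y).injective
    simp [hFa])
  by_cases hA : A.IsZero
  · exact Or.inl hA
  · right
    unfold IsZero at hA
    push Not at hA
    obtain ⟨x, hx⟩ := hA
    obtain ⟨a, ha⟩ := exists_ne (0 : A.obj x)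
    have h1 := congrArg (F x) (hc x ((F x).symm (a, 0)))
    simp at h1
    have hc1 : c = 1 := by
      have h2 : (1 - c) • a = 0 := by rw [sub_smul, one_smul, ← h1, sub_self]
      rcases smul_eq_zero.1 h2 with h3 | h3
      · exact (sub_eq_zero.1 h3).symm
      · exact absurd h3 ha
    intro y
    refine subsingleton_of_forall_eq 0 fun b => ?_
    have h2 := congrArg (F y) (hc y ((F y).symm (0, b)))
    simpa [hc1, eq_comm] using h2

theorem isSummand_refl (V : QuiverRep.{u, v, q, w} K Q) : V.IsSummand V := by
  refine ⟨⟨fun _ => PUnit, fun _ => 0⟩, fun x => LinearMap.inl K _ _, ?_, fun x => ?_⟩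
  · intro x y a
    ext m
    rfl
  · refine ⟨LinearMap.inl_injective, ?_⟩
    rintro ⟨m, ⟨⟩⟩
    exact ⟨m, rfl⟩

section Finite

variable [Fintype Q] [∀ x y : Q, Fintype (x ⟶ y)]

theorem defect_ne_zero_of_not_isRegular {V : QuiverRep.{u, v, q, w} K Q} {δ : Q → ℤ}
    (hV : Module.finrank K (Hom V V) = 1) (hreg : ¬ V.IsRegular δ) :
    eulerForm δ V.dimVec ≠ 0 := by
  unfold IsRegular at hreg
  push Not at hreg
  obtain ⟨W, hW, ⟨U, hU⟩, hne⟩ := hreg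
  have hUz : U.IsZero := ((isIndecomposable_of_finrank_hom_self hV).2 W U hU).resolve_left hW.1
  obtain ⟨f, -, hbij⟩ := hU
  have hdim : V.dimVec = W.dimVec := by
    funext x
    have h1 : Module.finrank K (V.obj x) = Module.finrank K (W.obj x × U.obj x) :=
      (LinearEquiv.ofBijective (f x) (hbij x)).finrank_eq
    have := hUz x
    rw [Module.finrank_prod, Module.finrank_zero_of_subsingleton (M := U.obj x), add_zero] at h1
    exact congrArg Nat.cast h1
  rw [hdim]
  exact hne

variable {h : Q → ℤ}

/-- A brick of nonzero defect has no self-extensions, since its Tits form is positive. -/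
theorem finrank_DExt_self_eq_zero (H : IsAdditiveWeight h) {X : QuiverRep.{u, v, q, w} K Q}
    (hX : Module.finrank K (Hom X X) = 1) (hdef : eulerForm h X.dimVec ≠ 0) :
    Module.finrank K (DExt X X) = 0 := by
  have h1 := finrank_hom_sub_finrank_DExt X X
  have h2 := H.eulerForm_pos hdef
  omega

section Tau

variable [∀ x y : Q, Finite (Quiver.Path x y)]

/-- A brick `X` of positive defect is not projective: otherwise `⟨dim X, h⟩ = -⟨h, dim X⟩ < 0` would
be the dimension of `Hom_Q(X, Z)` for a representation `Z` with `dim Z = h`. -/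
theorem hom_proj_eq_bot_of_defect_pos (H : IsAdditiveWeight h) {X : QuiverRep.{u, v, q, w} K Q}
    (hX : Module.finrank K (Hom X X) = 1) (hdef : 0 < eulerForm h X.dimVec) (y : Q) :
    Hom X (proj K y) = ⊥ := by
  rcases hom_proj_eq_bot_or.{u, v, q, w, u} hX with h1 | h1
  · exact h1 y
  · have h2 := finrank_hom_sub_finrank_DExt X (ofDim K fun x => (h x).toNat)
    have h3 : (fun x => ((h x).toNat : ℤ)) = h := funext fun x => Int.toNat_of_nonneg (H.pos x).le
    rw [h1, dimVec_ofDim, h3] at h2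
    have h4 := H.eulerForm_symm_eq_zero X.dimVec
    omega

theorem defect_tau (H : IsAdditiveWeight h) {X : QuiverRep.{u, v, q, w} K Q}
    (hX : ∀ y, Hom X (proj K y) = ⊥) :
    eulerForm h (tau X).dimVec = eulerForm h X.dimVec := by
  rw [eulerForm_tau_right hX]
  have := H.eulerForm_symm_eq_zero X.dimVec
  omega

/-- A brick `P` of negative defect and a brick `I` of positive defect with `Ext¹_Q(P, I) ≠ 0`. -/
structure IsBadPair (h : Q → ℤ) (P I : QuiverRep.{u, v, q, w} K Q) : Prop where
  brick_left : Module.finrank K (Hom P P) = 1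
  brick_right : Module.finrank K (Hom I I) = 1
  defect_left : eulerForm h P.dimVec < 0
  defect_right : 0 < eulerForm h I.dimVec
  ext_ne : Module.finrank K (DExt P I) ≠ 0

theorem IsBadPair.hom_proj_eq_bot {P I : QuiverRep.{u, v, q, w} K Q} (hPI : IsBadPair h P I)
    (y : Q) : Hom P (proj K y) = ⊥ := by
  rcases hom_proj_eq_bot_or.{u, v, q, w, w} hPI.brick_left with h1 | h1
  · exact h1 y
  · exact absurd (h1 I) hPI.ext_ne

theorem IsBadPair.tau (H : IsAdditiveWeight h) {P I : QuiverRep.{u, v, q, w} K Q}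
    (hPI : IsBadPair h P I) : IsBadPair h (tau P) (tau I) := by
  have hP := hPI.hom_proj_eq_bot
  have hI := hom_proj_eq_bot_of_defect_pos H hPI.brick_right hPI.defect_right
  refine ⟨finrank_hom_tau_self hPI.brick_left hP, finrank_hom_tau_self hPI.brick_right hI, ?_, ?_,
    ?_⟩
  · rw [defect_tau H hP]
    exact hPI.defect_left
  · rw [defect_tau H hI]
    exact hPI.defect_right
  · rw [finrank_DExt_tau hI, finrank_hom_tau]
    exact hPI.ext_ne

/-- `Ext¹_Q(P, I) = 0` for bricks `P` of negative and `I` of positive defect: otherwise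
`τ` could be applied to the pair for ever, which contradicts
`IsAdditiveWeight.not_coxeter_orbit`. -/
theorem not_isBadPair (H : IsAdditiveWeight h) {P I : QuiverRep.{u, v, q, w} K Q} :
    ¬ IsBadPair h P I := by
  intro hPI
  let T := {X : QuiverRep.{u, v, q, max u v q w} K Q × QuiverRep.{u, v, q, max u v q w} K Q //
    IsBadPair h X.1 X.2}
  let t : ℕ → T := fun k => Nat.rec ⟨(QuiverRep.tau P, QuiverRep.tau I), hPI.tau H⟩
    (fun _ X => ⟨(QuiverRep.tau X.1.1, QuiverRep.tau X.1.2), X.2.tau H⟩) k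
  refine H.not_coxeter_orbit (p := fun k => (t k).1.1.dimVec) (fun k x => Int.natCast_nonneg _)
    (fun k => ?_) (fun k => (t k).2.defect_left)
    (fun k => eulerForm_tau_right (t k).2.hom_proj_eq_bot)
  have h1 := finrank_hom_sub_finrank_DExt (t k).1.1 (t k).1.1
  rw [(t k).2.brick_left, finrank_DExt_self_eq_zero H (t k).2.brick_left
    (t k).2.defect_left.ne] at h1
  exact h1.symm

end Tau

/-- Among finitely many Hom-orthogonal bricks whose defects do not add up to `0`, one has no
extensions by the others. Otherwise the sum `s` of their dimension vectors would satisfy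
`q(s) ≤ 0`, as each summand contributes `1` to `q(s)` through its endomorphisms and at least `-1`
through an extension. -/
theorem exists_first (H : IsAdditiveWeight h) {ι : Type*} {V : ι → QuiverRep.{u, v, q, w} K Q}
    (hV : ∀ i, Module.finrank K (Hom (V i) (V i)) = 1)
    (horth : ∀ i j, i ≠ j → Hom (V i) (V j) = ⊥) {A : Finset ι}
    (hA : eulerForm h (∑ i ∈ A, (V i).dimVec) ≠ 0) :
    ∃ i ∈ A, ∀ j ∈ A, j ≠ i → Module.finrank K (DExt (V i) (V j)) = 0 := by
  classical
  by_contra hcon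
  push Not at hcon
  have h1 := H.eulerForm_pos hA
  rw [← eulerBilin_apply] at h1
  simp only [map_sum, LinearMap.sum_apply, eulerBilin_apply] at h1
  rw [Finset.sum_comm] at h1
  refine absurd h1 (not_lt.2 (Finset.sum_nonpos fun i hi => ?_))
  obtain ⟨k, hk, hki, hne⟩ := hcon i hi
  have h2 : ∀ j ∈ A, eulerForm (V i).dimVec (V j).dimVec ≤
      (if j = i then 1 else 0) - (if j = k then 1 else 0) := by
    intro j _
    rw [← finrank_hom_sub_finrank_DExt]
    by_cases hji : j = i
    · subst hji
      rw [hV, if_pos rfl, if_neg (Ne.symm hki)]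
      omega
    · rw [horth i j (Ne.symm hji), finrank_bot, if_neg hji]
      split_ifs with hjk
      · subst hjk
        omega
      · omega
  refine (Finset.sum_le_sum h2).trans ?_
  rw [Finset.sum_sub_distrib, Finset.sum_ite_eq', Finset.sum_ite_eq', if_pos hi, if_pos hk,
    sub_self]

/-- An imaginary Schur root is a positive rational multiple of the additive weight. -/
theorem exists_smul_eq_smul_of_isImaginarySchurRoot (H : IsAdditiveWeight h) {δ : Q → ℤ}
    (hδ : IsImaginarySchurRoot K δ) : ∃ n m : ℤ, 0 < n ∧ 0 < m ∧ n • δ = m • h := by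
  obtain ⟨⟨U, hU, rfl⟩, hq⟩ := hδ
  obtain ⟨n, m, hn, hnm⟩ := H.exists_smul_eq_smul hq
  refine ⟨n, m, hn, ?_, hnm⟩
  have hz := not_isZero_of_finrank_hom_self hU.finrank_hom_self
  unfold IsZero at hz
  push Not at hz
  obtain ⟨x, hx⟩ := hz
  have h1 : 0 < U.dimVec x := by
    unfold dimVec
    exact_mod_cast Module.finrank_pos
  have h2 : n * U.dimVec x = m * h x := congrFun hnm x
  have h3 : 0 < m * h x := h2 ▸ mul_pos hn h1
  exact (mul_pos_iff_of_pos_right (H.pos x)).1 h3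

end Finite

end QuiverRep

theorem corollary3p7 {K : Type u} [Field K] [IsAlgClosed K] [CharZero K]
    {Q : Type v} [Quiver.{q} Q] [Fintype Q] [∀ x y : Q, Fintype (x ⟶ y)]
    (hQ : IsEuclideanQuiver Q)
    (δ : Q → ℤ) (hδ : IsImaginarySchurRoot K δ)
    {r : ℕ} (V : Fin r → QuiverRep.{u, v, q, w} K Q)
    (hV : QuiverRep.IsOrthogonalSchurSequence V)
    (hreg : ∀ i, ¬ (V i).IsRegular δ) :
    ∃ σ : Equiv.Perm (Fin r),
      QuiverRep.IsOrthogonalExceptionalSequence (fun i => V (σ i)) ∧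
      ∀ i j, (V (σ i)).IsPreprojective δ → (V (σ j)).IsPreinjective δ → i < j := by
  have := hQ.finite_path
  obtain ⟨h, H⟩ := hQ.exists_isAdditiveWeight
  obtain ⟨n, m, hn, hm, hnm⟩ := QuiverRep.exists_smul_eq_smul_of_isImaginarySchurRoot H hδ
  have hbrick : ∀ i, Module.finrank K (QuiverRep.Hom (V i) (V i)) = 1 :=
    fun i => (hV.1 i).finrank_hom_self
  have hδh : ∀ α, n * eulerForm δ α = m * eulerForm h α := fun α => by
    rw [← eulerForm_smul_left, ← eulerForm_smul_left, hnm]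
  have hdef : ∀ i, eulerForm h (V i).dimVec ≠ 0 := by
    intro i h0
    have h1 := hδh (V i).dimVec
    rw [h0, mul_zero] at h1
    exact QuiverRep.defect_ne_zero_of_not_isRegular (hbrick i) (hreg i)
      ((mul_eq_zero.1 h1).resolve_left hn.ne')
  have hsum : ∀ A : Finset (Fin r), eulerForm h (∑ i ∈ A, (V i).dimVec) =
      ∑ i ∈ A, eulerForm h (V i).dimVec := fun A => map_sum (eulerBilin h) _ A
  obtain ⟨σ, hσ⟩ := exists_perm_of_exists_first
    (ok := fun i j => Module.finrank K (QuiverRep.DExt (V i) (V j)) = 0 ∧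
      ¬ (0 < eulerForm h (V i).dimVec ∧ eulerForm h (V j).dimVec < 0)) (by
    intro A hA
    rcases (A.filter fun i => eulerForm h (V i).dimVec < 0).eq_empty_or_nonempty with hN | hN
    · have hpos : ∀ i ∈ A, 0 < eulerForm h (V i).dimVec := fun i hi =>
        lt_of_le_of_ne (not_lt.1 (Finset.filter_eq_empty_iff.1 hN hi)) (hdef i).symm
      obtain ⟨i, hi, hij⟩ := QuiverRep.exists_first H hbrick hV.2 (A := A) (by
        rw [hsum]
        exact (Finset.sum_pos hpos hA).ne')
      exact ⟨i, hi, fun j hj hji => ⟨hij j hj hji, fun h1 => h1.2.not_gt (hpos j hj)⟩⟩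
    · obtain ⟨i, hi, hij⟩ := QuiverRep.exists_first H hbrick hV.2
        (A := A.filter fun i => eulerForm h (V i).dimVec < 0) (by
        rw [hsum]
        exact (Finset.sum_neg (fun i hi => (Finset.mem_filter.1 hi).2) hN).ne)
      rw [Finset.mem_filter] at hi
      refine ⟨i, hi.1, fun j hj hji => ⟨?_, fun h1 => h1.1.not_gt hi.2⟩⟩
      rcases (hdef j).lt_or_gt with hneg | hpos
      · exact hij j (Finset.mem_filter.2 ⟨hj, hneg⟩) hji
      · by_contra hne
        exact QuiverRep.not_isBadPair H ⟨hbrick i, hbrick j, hi.2, hpos, hne⟩)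
  have hext : ∀ i j, Module.finrank K (QuiverRep.DExt (V i) (V j)) = 0 →
      QuiverRep.ExtOneVanishes (V i) (V j) := fun i j h0 =>
    QuiverRep.extOneVanishes_of_surjective_coboundary ((QuiverRep.surjective_coboundary_iff _ _).2 h0)
  have horth : ∀ i j, i ≠ j → QuiverRep.Hom (V (σ i)) (V (σ j)) = ⊥ := fun i j hij =>
    hV.2 _ _ (σ.injective.ne hij)
  refine ⟨σ, ⟨⟨fun i => ⟨hV.1 _, hext _ _ (QuiverRep.finrank_DExt_self_eq_zero H (hbrick _)
    (hdef _))⟩, fun i j hij => ⟨horth i j hij.ne, hext _ _ (hσ i j hij).1⟩⟩, horth⟩, ?_⟩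
  intro i j hi hj
  have hi' : eulerForm δ (V (σ i)).dimVec < 0 := hi _
    (QuiverRep.isIndecomposable_of_finrank_hom_self (hbrick _)) (QuiverRep.isSummand_refl _)
  have hj' : 0 < eulerForm δ (V (σ j)).dimVec := hj _
    (QuiverRep.isIndecomposable_of_finrank_hom_self (hbrick _)) (QuiverRep.isSummand_refl _)
  by_contra hij
  rcases (not_lt.1 hij).eq_or_lt with rfl | hlt
  · exact lt_asymm hi' hj'
  · refine (hσ j i hlt).2 ⟨?_, ?_⟩
    · rw [← mul_pos_iff_of_pos_left hm, ← hδh]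
      exact mul_pos hn hj'
    · by_contra hge
      exact absurd (mul_neg_of_pos_of_neg hn hi')
        (not_lt.2 (hδh _ ▸ mul_nonneg hm.le (not_lt.1 hge)))
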